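/- Let $n\ge 1$, $C>1$ and $C_1,C_2\in\mathbb R$. There is a constant $K\ge 1$, depending only on $C$, $C_1$, $C_2$ and $n$, such that the following holds. Let $M$ be a smooth $n$-manifold (without boundary, not necessarily compact). A Finsler metric on $M$ is a continuous function $F\colon TM\to[0,\infty)$ that is $C^\infty$ off the zero section, satisfies $F(x,\lambda v)=\lambda F(x,v)$ for $\lambda>0$, vanishes exactly on the zero section, and is such that the Hessian of $F^2(x,\cdot)$ is positive definite at every $v\neq 0$. Its quasireversibility constant is $\sup\{F(x,-v) : (x,v)\in TM,\ F(x,v)=1\}$. Let $\pi\colon HM=(TM\smallsetminus 0)/\mathbb R_{>0}\to M$ be the bundle of tangent directions, and let $A$ be the Hilbert form of $F$, i.e. the $1$-form on $HM$ given by $A_{(x,[v])}(Z)=\frac{d}{d\varepsilon}\big|_{\varepsilon=0}F(x,v+\varepsilon\, d\pi(Z))$. It is a contact form; let $X$ be its Reeb field, $A(X)=1$ and $i_X dA=0$. For $f\in H^1_{loc}(M)$ (i.e. $f$ is in $L^2_{loc}$ with a weak differential $df$ in $L^2_{loc}$), put $L_X(\pi^*f)=df(d\pi(X))$ and define the energy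 $$E^F(f)=\frac{n}{\operatorname{vol}(\mathbb S^{n-1})}\int_{HM}\left|L_X(\pi^*f)\right|^2\,A\wedge dA^{n-1}\in[0,\infty],$$ where $HM$ is oriented by $A\wedge dA^{n-1}$. Let $F$ and $F_0$ be Finsler metrics on $M$ with (finite) quasireversibility constants $C_1$ and $C_2$ respectively, such that $C^{-1}\le F(x,v)/F_0(x,v)\le C$ for all $(x,v)\in TM$ with $v\ne0$. Then for every $f\in H^1_{loc}(M)$, in particular for every $f\in H^1(M)$, $$C^{-K}\,E^{F_0}(f)\le E^F(f)\le C^{K}\,E^{F_0}(f).$$ Hence $C^{-K}\le E^F(f)/E^{F_0}(f)\le C^K$ whenever $0<E^{F_0}(f)<\infty$. -/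

import Mathlib

open Set MeasureTheory
open scoped Manifold ContDiff ENNReal

noncomputable section

namespace Finsler

/-- The model space `ℝⁿ` of an `n`-dimensional manifold, where `n = d + 1 ≥ 1`. -/
abbrev Model (d : ℕ) : Type := EuclideanSpace ℝ (Fin (d + 1))

/-- Smooth Finsler metrics on a manifold `M` of dimension `n = d + 1`. -/
structure FinslerMetric (d : ℕ) (M : Type*) [TopologicalSpace M] [ChartedSpace (Model d) M]
    [IsManifold 𝓘(ℝ, Model d) ∞ M] where
  /-- The function `F : TM → ℝ`. -/
  toFun : TangentBundle 𝓘(ℝ, Model d) M → ℝ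
  continuous_toFun : Continuous toFun
  /-- Smoothness away from the zero section. -/
  smooth : ContMDiffOn 𝓘(ℝ, Model d).tangent 𝓘(ℝ, ℝ) ∞ toFun {p | p.2 ≠ 0}
  /-- Positive homogeneity. -/
  homogeneous : ∀ (x : M) (v : TangentSpace 𝓘(ℝ, Model d) x) (t : ℝ), 0 < t →
    toFun ⟨x, t • v⟩ = t * toFun ⟨x, v⟩
  nonneg : ∀ p, 0 ≤ toFun p
  eq_zero_iff : ∀ (x : M) (v : TangentSpace 𝓘(ℝ, Model d) x), toFun ⟨x, v⟩ = 0 ↔ v = 0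
  /-- Strong convexity: the vertical Hessian of `F²` is positive definite off the zero section. -/
  strongly_convex : ∀ (x : M) (v u : Model d), v ≠ 0 → u ≠ 0 →
    0 < fderiv ℝ (fderiv ℝ (fun w : Model d => toFun ⟨x, w⟩ ^ 2)) v u u

section Exterior

variable {V : Type*} [NormedAddCommGroup V] [NormedSpace ℝ V]

/-- A field of linear forms, seen as a differential `1`-form. -/
def oneForm (A : V → V →L[ℝ] ℝ) : V → V [⋀^Fin 1]→L[ℝ] ℝ :=
  fun p => ContinuousAlternatingMap.ofSubsingleton ℝ V ℝ (0 : Fin 1) (A p)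

/-- The exterior derivative `dA` of the `1`-form `A`. -/
def dOneForm (A : V → V →L[ℝ] ℝ) : V → V [⋀^Fin 2]→L[ℝ] ℝ :=
  extDeriv (oneForm A)

/-- The value of `a ∧ b ∧ ⋯ ∧ b` (with `d` factors `b`) on `2 d + 1` vectors, for a linear form `a`
and an alternating `2`-form `b`:
`(a ∧ bᵈ)(v) = (1! (2!)ᵈ)⁻¹ ∑_σ sign σ · a(v_{σ 0}) · ∏ᵢ b(v_{σ (2i+1)}, v_{σ (2i+2)})`.
The `2 d + 1` slots are named `none` (in the place of `0`), `some (i, false)` (in the place of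
`2 i + 1`) and `some (i, true)` (in the place of `2 i + 2`). -/
def wedgePow {d : ℕ} (a : V →L[ℝ] ℝ) (b : V [⋀^Fin 2]→L[ℝ] ℝ)
    (v : Option (Fin d × Bool) → V) : ℝ :=
  ((2 : ℝ) ^ d)⁻¹ * ∑ σ : Equiv.Perm (Option (Fin d × Bool)),
    ((Equiv.Perm.sign σ : ℤ) : ℝ) * a (v (σ none)) *
      ∏ i : Fin d, b ![v (σ (some (i, false))), v (σ (some (i, true)))]

/-- `X` is a value at `p` of the Reeb field of `A`: `A(X) = 1` and `i_X dA = 0`. -/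
def IsReebAt (A : V → V →L[ℝ] ℝ) (p X : V) : Prop :=
  A p X = 1 ∧ ∀ Z : V, dOneForm A p ![X, Z] = 0

/-- The Reeb field of the `1`-form `A` (which is unique where `A` is a contact form). -/
def reeb (A : V → V →L[ℝ] ℝ) (p : V) : V :=
  Classical.epsilon (IsReebAt A p)

end Exterior

section HomogenizedBundle

/-- Coordinates `(y, w)` on the homogenized bundle `HM = (TM ∖ 0) / ℝ₊`, of dimension
`2 n - 1 = 2 d + 1`: `y` is the coordinate of the base point in a chart of `M`, and `w` is an affine
coordinate on the set of directions. -/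
abbrev HCoord (d : ℕ) : Type := Model d × EuclideanSpace ℝ (Fin d)

/-- For a sign `s = ± 1`, the vector `(s, w₁, …, w_d)`. The directions of these vectors, for
`w ∈ ℝᵈ`, form the open half `{s v₀ > 0}` of the sphere of directions of `ℝⁿ`; the two halves
together miss only the equator `{v₀ = 0}`, which is a null set. -/
def direction {d : ℕ} (s : ℤˣ) (w : EuclideanSpace ℝ (Fin d)) : Model d :=
  WithLp.toLp 2 (Fin.cons ((s : ℤ) : ℝ) (fun i => w i))

/-- The coordinate frame of `HCoord d`, in the order
`∂/∂y₀, ∂/∂y₁, ∂/∂w₀, ∂/∂y₂, ∂/∂w₁, …`. -/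
def coordFrame (d : ℕ) : Option (Fin d × Bool) → HCoord d
  | none => (EuclideanSpace.single 0 1, 0)
  | some (i, false) => (EuclideanSpace.single i.succ 1, 0)
  | some (i, true) => (0, EuclideanSpace.single i 1)

variable {d : ℕ} {M : Type*} [TopologicalSpace M] [ChartedSpace (Model d) M]
  [IsManifold 𝓘(ℝ, Model d) ∞ M]

/-- The Finsler metric read in the coordinates of `TM` induced by a chart `e` of `M`. -/
def FinslerMetric.inChart (F : FinslerMetric d M) (e : OpenPartialHomeomorph M (Model d))
    (y v : Model d) : ℝ :=
  F.toFun (tangentMap 𝓘(ℝ, Model d) 𝓘(ℝ, Model d) e.symm ⟨y, v⟩)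

/-- The Hilbert form `A` of `F`, a `1`-form on `HM`, in the coordinates `(y, w)`:
`A_{(x, ξ)}(Z)` is the derivative of `F(x, ·)` at a representative `v` of `ξ` in the direction
`dπ(Z)`. -/
def FinslerMetric.hilbertForm (F : FinslerMetric d M) (e : OpenPartialHomeomorph M (Model d))
    (s : ℤˣ) (p : HCoord d) : HCoord d →L[ℝ] ℝ :=
  (fderiv ℝ (F.inChart e p.1) (direction s p.2)).comp
    (ContinuousLinearMap.fst ℝ (Model d) (EuclideanSpace ℝ (Fin d)))

/-- The density of the volume form `A ∧ dAⁿ⁻¹` with respect to Lebesgue measure in the coordinates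
`(y, w)`. The absolute value accounts for the orientation of `HM` by `A ∧ dAⁿ⁻¹` itself. -/
def FinslerMetric.contactDensity (F : FinslerMetric d M)
    (e : OpenPartialHomeomorph M (Model d)) (s : ℤˣ) (p : HCoord d) : ℝ :=
  |wedgePow (F.hilbertForm e s p) (dOneForm (F.hilbertForm e s) p) (coordFrame d)|

end HomogenizedBundle

section Sobolev

variable {d : ℕ}

/-- `u` belongs to `L²_loc(U)`. -/
def MemL2Loc {G : Type*} [NormedAddCommGroup G] (U : Set (Model d)) (u : Model d → G) : Prop :=
  ∀ S ⊆ U, IsCompact S → MemLp u 2 (volume.restrict S)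

/-- On the open set `U`, `u ∈ L²_loc` has the weak differential `g ∈ L²_loc`. -/
def HasWeakGradientOn (U : Set (Model d)) (u : Model d → ℝ) (g : Model d → Model d →L[ℝ] ℝ) :
    Prop :=
  MemL2Loc U u ∧ MemL2Loc U g ∧
    ∀ φ : Model d → ℝ, ContDiff ℝ ∞ φ → HasCompactSupport φ → tsupport φ ⊆ U →
      ∀ v : Model d, ∫ y, u y * fderiv ℝ φ y v = - ∫ y, g y v * φ y

variable {M : Type*} [TopologicalSpace M] [ChartedSpace (Model d) M]

/-- A field of covectors on `M` (with no regularity) read in a chart `e`. -/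
def covectorInChart (η : ∀ x : M, TangentSpace 𝓘(ℝ, Model d) x →L[ℝ] ℝ)
    (e : OpenPartialHomeomorph M (Model d)) (y : Model d) : Model d →L[ℝ] ℝ :=
  (η (e.symm y)).comp (mfderiv 𝓘(ℝ, Model d) 𝓘(ℝ, Model d) e.symm y)

/-- `η` is a weak differential of `f`, both being of class `L²_loc`. -/
def IsWeakDifferential (f : M → ℝ) (η : ∀ x : M, TangentSpace 𝓘(ℝ, Model d) x →L[ℝ] ℝ) :
    Prop :=
  ∀ e ∈ atlas (Model d) M, HasWeakGradientOn e.target (f ∘ e.symm) (covectorInChart η e)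

variable (d) in
/-- `f` belongs to `H¹_loc(M)`: it is in `L²_loc` with a weak differential in `L²_loc`. -/
def MemH1Loc (f : M → ℝ) : Prop :=
  ∃ η : ∀ x : M, TangentSpace 𝓘(ℝ, Model d) x →L[ℝ] ℝ, IsWeakDifferential f η

open Classical in
variable (d) in
/-- The weak differential `df` of `f ∈ H¹_loc(M)`, which is unique up to null sets. -/
def weakDifferential (f : M → ℝ) (x : M) : TangentSpace 𝓘(ℝ, Model d) x →L[ℝ] ℝ :=
  if h : MemH1Loc d f then h.choose x else 0

end Sobolev

section Energy

variable {d : ℕ} {M : Type*} [TopologicalSpace M] [ChartedSpace (Model d) M]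
  [IsManifold 𝓘(ℝ, Model d) ∞ M]

/-- The function `L_X(π^* f) = df(dπ(X))` on `HM`, in coordinates, where `X` is the Reeb field of the
Hilbert form. -/
def FinslerMetric.lieReeb (F : FinslerMetric d M) (f : M → ℝ)
    (e : OpenPartialHomeomorph M (Model d)) (s : ℤˣ) (p : HCoord d) : ℝ :=
  covectorInChart (weakDifferential d f) e p.1 (reeb (F.hilbertForm e s) p).1

variable (d M) in
/-- A Borel piece of `M` contained in the domain of a chart. -/
structure ChartPiece where
  chart : OpenPartialHomeomorph M (Model d)
  chart_mem : chart ∈ atlas (Model d) M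
  carrier : Set M
  measurable : MeasurableSet[borel M] carrier
  subset_source : carrier ⊆ chart.source

/-- `∫ |L_X(π^* f)|² A ∧ dAⁿ⁻¹` over the part of `HM` above a piece of `M`, in coordinates. -/
def FinslerMetric.energyOn (F : FinslerMetric d M) (f : M → ℝ) (P : ChartPiece d M) : ℝ≥0∞ :=
  ∑ s : ℤˣ, ∫⁻ p in (P.chart '' P.carrier) ×ˢ (univ : Set (EuclideanSpace ℝ (Fin d))),
    ENNReal.ofReal (F.lieReeb f P.chart s p ^ 2 * F.contactDensity P.chart s p)

/-- The energy `E^F(f) = n / vol(Sⁿ⁻¹) ∫_{HM} |L_X(π^* f)|² A ∧ dAⁿ⁻¹ ∈ [0, ∞]`. The integrand is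
nonnegative, and its integral over `HM` is the supremum, over the finite families of disjoint
Borel pieces of `M` lying in charts, of the integrals above these pieces. -/
def FinslerMetric.energy (F : FinslerMetric d M) (f : M → ℝ) : ℝ≥0∞ :=
  ENNReal.ofReal
      (((d + 1 : ℕ) : ℝ) / (volume : Measure (Model d)).toSphere.real univ) *
    ⨆ (S : Finset (ChartPiece d M)) (_ : (S : Set (ChartPiece d M)).PairwiseDisjoint
      ChartPiece.carrier), ∑ P ∈ S, F.energyOn f P

/-- `C₁` is the quasireversibility constant of `F`:
`C₁ = sup {F(x, -v) | (x, v) ∈ TM, F(x, v) = 1}`, the supremum being finite. -/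
def FinslerMetric.IsQuasireversibilityConstant (F : FinslerMetric d M) (C₁ : ℝ) : Prop :=
  IsLUB {r : ℝ | ∃ (x : M) (v : TangentSpace 𝓘(ℝ, Model d) x),
    F.toFun ⟨x, v⟩ = 1 ∧ r = F.toFun ⟨x, -v⟩} C₁

/-- `F` and `F₀` are `C`-bi-Lipschitz: `C⁻¹ ≤ F / F₀ ≤ C` on nonzero tangent vectors. -/
def FinslerMetric.BiLipschitz (F F₀ : FinslerMetric d M) (C : ℝ) : Prop :=
  ∀ (x : M) (v : TangentSpace 𝓘(ℝ, Model d) x), v ≠ 0 →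
    C⁻¹ ≤ F.toFun ⟨x, v⟩ / F₀.toFun ⟨x, v⟩ ∧ F.toFun ⟨x, v⟩ / F₀.toFun ⟨x, v⟩ ≤ C

end Energy

end Finsler

end

/- In a chart, the contact volume of `HM` and the Reeb field are those of a fibrewise object: if
`p(w) = ∂F/∂v` denotes the momentum of the direction `w`, then `A ∧ dAⁿ⁻¹` has density
`|det(p, ∂₁p, …, ∂_d p)|` up to a constant of the dimension, and the Reeb field projects to the
`F`-unit vector in the direction `w`. In polar coordinates `ξ = r p(w)` on the dual unit ball `B*`
the energy density of a covector `η` therefore becomes, up to the factor `n`,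
`∫_{B*} ⟨η, v(ξ)⟩² dξ`, where `v(ξ)` is the unit vector dual to `ξ`. This integral is comparable to
`F*(η)² vol(B*)`: quasireversibility bounds the integrand by a multiple of `F*(η)²`, and
`⟨η, v(ξ)⟩ ≥ F*(η) / 2` on a translated and shrunken copy of `B*` inside `B*`. Both `F*(η)` and
`vol(B*)` change by at most a power of `C` when `F` is replaced by a `C`-bi-Lipschitz metric. -/

noncomputable section

namespace Finsler

open scoped Gradient Pointwise

section ExteriorPower

variable {V : Type*} [NormedAddCommGroup V] [NormedSpace ℝ V] {d : ℕ}

lemma exists_linearMap_eq_tensor_update (a : V →L[ℝ] ℝ) (b : V [⋀^Fin 2]→L[ℝ] ℝ)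
    (v : Option (Fin d × Bool) → V) (j : Option (Fin d × Bool)) :
    ∃ ℓ : V →ₗ[ℝ] ℝ, ∀ z, a (Function.update v j z none) *
      ∏ i, b ![Function.update v j z (some (i, false)), Function.update v j z (some (i, true))] =
        ℓ z := by
  rcases j with _ | ⟨k, c⟩
  · exact ⟨(∏ i, b ![v (some (i, false)), v (some (i, true))]) • a.toLinearMap,
      fun z => by simp [mul_comm]⟩
  · have h_rest : ∀ z, ∀ i ∈ Finset.univ.erase k,
        b ![Function.update v (some (k, c)) z (some (i, false)),
          Function.update v (some (k, c)) z (some (i, true))] =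
        b ![v (some (i, false)), v (some (i, true))] := by
      intro z i hi
      simp [Finset.ne_of_mem_erase hi]
    have h_left (y z : V) : Function.update ![0, y] 0 z = ![z, y] := by
      ext i; fin_cases i <;> simp
    have h_right (x z : V) : Function.update ![x, 0] 1 z = ![x, z] := by
      ext i; fin_cases i <;> simp
    refine ⟨(a (v none) * ∏ i ∈ Finset.univ.erase k,
      b ![v (some (i, false)), v (some (i, true))]) •
        bif c then b.toMultilinearMap.toLinearMap ![v (some (k, false)), 0] 1
          else b.toMultilinearMap.toLinearMap ![0, v (some (k, true))] 0, fun z => ?_⟩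
    rw [← Finset.mul_prod_erase _ _ (Finset.mem_univ k), Finset.prod_congr rfl (h_rest z)]
    cases c <;> simp [h_left, h_right] <;> ring

/-- The multilinear map `v ↦ a(v₀) ∏ᵢ b(v₂ᵢ₊₁, v₂ᵢ₊₂)` of which `a ∧ bᵈ` is, up to a factor, the
alternatization; the slots are named as in `wedgePow`. -/
def tensorPow (a : V →L[ℝ] ℝ) (b : V [⋀^Fin 2]→L[ℝ] ℝ) :
    MultilinearMap ℝ (fun _ : Option (Fin d × Bool) => V) ℝ :=
  MultilinearMap.mk'
    (fun v => a (v none) * ∏ i : Fin d, b ![v (some (i, false)), v (some (i, true))])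
    (fun v j x y => by
      obtain ⟨ℓ, hℓ⟩ := exists_linearMap_eq_tensor_update a b v j
      simp only [hℓ, map_add])
    (fun v j t x => by
      obtain ⟨ℓ, hℓ⟩ := exists_linearMap_eq_tensor_update a b v j
      simp only [hℓ, map_smul])

lemma wedgePow_eq_alternatization (a : V →L[ℝ] ℝ) (b : V [⋀^Fin 2]→L[ℝ] ℝ)
    (v : Option (Fin d × Bool) → V) :
    wedgePow a b v = (2 ^ d)⁻¹ * MultilinearMap.alternatization (tensorPow a b) v := by
  simp only [wedgePow, MultilinearMap.alternatization_apply, MultilinearMap.domDomCongr_apply,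
    Units.smul_def, zsmul_eq_mul, mul_assoc]
  rfl

lemma wedgePow_map (hV : Module.finrank ℝ V = 2 * d + 1) (a : V →L[ℝ] ℝ)
    (b : V [⋀^Fin 2]→L[ℝ] ℝ) (T : V →ₗ[ℝ] V) (v : Option (Fin d × Bool) → V) :
    wedgePow a b (T ∘ v) = LinearMap.det T * wedgePow a b v := by
  have : FiniteDimensional ℝ V := .of_finrank_pos (by omega)
  let e : Module.Basis (Option (Fin d × Bool)) ℝ V :=
    (Module.finBasis ℝ V).reindex (Fintype.equivOfCardEq (by simp [hV, mul_comm]))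
  rw [wedgePow_eq_alternatization, wedgePow_eq_alternatization,
    (MultilinearMap.alternatization (tensorPow a b)).eq_smul_basis_det e]
  simp only [AlternatingMap.smul_apply, Module.Basis.det_comp, smul_eq_mul]
  ring

lemma alternating_pair_swap (b : V [⋀^Fin 2]→L[ℝ] ℝ) (x y : V) : b ![x, y] = -b ![y, x] := by
  have h := b.toAlternatingMap.map_swap ![y, x] (i := 0) (j := 1) (by decide)
  have h_swap : ![y, x] ∘ Equiv.swap (0 : Fin 2) 1 = ![x, y] := by
    funext i; fin_cases i <;> simp
  rwa [h_swap] at h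

/-- Whether a slot of the coordinate frame holds a fibre direction `∂/∂wᵢ`. -/
def isFibreSlot (x : Option (Fin d × Bool)) : Bool := x.any Prod.snd

/-- There are `d` fibre slots and `d` pairs, and no pair takes two fibre slots. -/
lemma isFibreSlot_or_of_perm (σ : Equiv.Perm (Option (Fin d × Bool)))
    (h_none : isFibreSlot (σ none) = false)
    (h_pair : ∀ i, ¬(isFibreSlot (σ (some (i, false))) ∧ isFibreSlot (σ (some (i, true)))))
    (i : Fin d) : isFibreSlot (σ (some (i, false))) ∨ isFibreSlot (σ (some (i, true))) := by
  let g : Option (Fin d × Bool) → ℕ := fun x => (isFibreSlot x).toNat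
  let pairCount : Fin d → ℕ := fun i => g (σ (some (i, true))) + g (σ (some (i, false)))
  have h_le : ∀ i ∈ Finset.univ, pairCount i ≤ 1 := by
    intro i _
    have := h_pair i
    simp only [pairCount, g]
    cases h₁ : isFibreSlot (σ (some (i, false))) <;>
      cases h₂ : isFibreSlot (σ (some (i, true))) <;> simp_all
  have h_sum : ∑ i, pairCount i = ∑ _i : Fin d, 1 := by
    have h_image_none : g (σ none) = 0 := by simp [g, h_none]
    have h_total := Equiv.sum_comp σ g
    simp only [Fintype.sum_option, Fintype.sum_prod_type, Fintype.sum_bool, h_image_none,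
      zero_add] at h_total
    rw [h_total]
    simp [g, isFibreSlot]
  have h_one := (Finset.sum_eq_sum_iff_of_le h_le).1 h_sum i (Finset.mem_univ i)
  by_contra! h
  simp [pairCount, g, h.1, h.2] at h_one

variable {W : Type*} [NormedAddCommGroup W] [NormedSpace ℝ W]

/-- The values of `b` on pairs of base slots do not contribute to `a ∧ bᵈ`. -/
lemma wedgePow_congr_of_isFibreSlot {a : V →L[ℝ] ℝ} {b : V [⋀^Fin 2]→L[ℝ] ℝ}
    {a' : W →L[ℝ] ℝ} {b' : W [⋀^Fin 2]→L[ℝ] ℝ} {v : Option (Fin d × Bool) → V}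
    {v' : Option (Fin d × Bool) → W} (h_one : ∀ x, a (v x) = a' (v' x))
    (h_two : ∀ x y, isFibreSlot x → b ![v x, v y] = b' ![v' x, v' y])
    (h_one_fibre : ∀ x, isFibreSlot x → a (v x) = 0)
    (h_two_fibre : ∀ x y, isFibreSlot x → isFibreSlot y → b ![v x, v y] = 0) :
    wedgePow a b v = wedgePow a' b' v' := by
  refine congrArg _ (Finset.sum_congr rfl fun σ _ => ?_)
  rw [← h_one]
  cases h_none : isFibreSlot (σ none) with
  | true => simp [h_one_fibre _ h_none]
  | false =>
    by_cases h_pair : ∃ i, isFibreSlot (σ (some (i, false))) ∧ isFibreSlot (σ (some (i, true)))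
    · obtain ⟨i, hi₁, hi₂⟩ := h_pair
      have hi := h_two_fibre _ _ hi₁ hi₂
      rw [Finset.prod_eq_zero (Finset.mem_univ i) hi,
        Finset.prod_eq_zero (Finset.mem_univ i) ((h_two _ _ hi₁).symm.trans hi)]
    · congr 1
      refine Finset.prod_congr rfl fun i _ => ?_
      rcases isFibreSlot_or_of_perm σ h_none (not_exists.1 h_pair) i with hi | hi
      · exact h_two _ _ hi
      · rw [alternating_pair_swap b, alternating_pair_swap b', h_two _ _ hi]

end ExteriorPower

section ExteriorDerivative

variable {V : Type*} [NormedAddCommGroup V] [NormedSpace ℝ V]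

lemma dOneForm_apply {A : V → V →L[ℝ] ℝ} {p : V} (hA : DifferentiableAt ℝ A p) (X Z : V) :
    dOneForm A p ![X, Z] = fderiv ℝ A p X Z - fderiv ℝ A p Z X := by
  have h_form : DifferentiableAt ℝ (oneForm A) p :=
    (ContinuousAlternatingMap.ofSubsingletonLIE (𝕜 := ℝ) (E := V) (F := ℝ)
      (0 : Fin 1)).differentiableAt.comp p hA
  have h_fderiv : ∀ Y W : V, fderiv ℝ (fun x => A x W) p Y = fderiv ℝ A p Y W := by
    intro Y W
    simp [(hA.hasFDerivAt.clm_apply (hasFDerivAt_const W p)).fderiv]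
  have h_zero : (fun x => oneForm A x ((0 : Fin 2).removeNth ![X, Z])) = fun x => A x Z := by
    funext x; simp [oneForm]
  have h_one : (fun x => oneForm A x ((1 : Fin 2).removeNth ![X, Z])) = fun x => A x X := by
    funext x; simp [oneForm, Fin.removeNth]
  rw [dOneForm, extDeriv_apply h_form, Fin.sum_univ_two, h_zero, h_one]
  simp [h_fderiv, sub_eq_add_neg]

variable {E G : Type*} [NormedAddCommGroup E] [InnerProductSpace ℝ E] [NormedAddCommGroup G]
  [NormedSpace ℝ G]

/-- The `1`-form `⟨N(y, w), dy⟩` on `E × G`, the shape of a Hilbert form in coordinates. -/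
def covectorForm (N : E × G → E) (p : E × G) : E × G →L[ℝ] ℝ :=
  (innerSL ℝ (N p)).comp (ContinuousLinearMap.fst ℝ E G)

lemma dOneForm_covectorForm {N : E × G → E} {p : E × G} (hN : DifferentiableAt ℝ N p)
    (X Z : E × G) : dOneForm (covectorForm N) p ![X, Z] =
      inner ℝ (fderiv ℝ N p X) Z.1 - inner ℝ (fderiv ℝ N p Z) X.1 := by
  have h_form : HasFDerivAt (covectorForm N) _ p :=
    ((innerSL ℝ).hasFDerivAt.comp p hN.hasFDerivAt).clm_comp
      (hasFDerivAt_const (ContinuousLinearMap.fst ℝ E G) p)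
  rw [dOneForm_apply h_form.differentiableAt, h_form.fderiv]
  simp [innerSL_apply_apply ℝ]

end ExteriorDerivative

section Directions

variable {d : ℕ}

lemma direction_zero (s : ℤˣ) (w : EuclideanSpace ℝ (Fin d)) :
    direction s w 0 = ((s : ℤ) : ℝ) := rfl

lemma direction_succ (s : ℤˣ) (w : EuclideanSpace ℝ (Fin d)) (k : Fin d) :
    direction s w k.succ = w k := rfl

lemma direction_ne_zero (s : ℤˣ) (w : EuclideanSpace ℝ (Fin d)) : direction s w ≠ 0 := by
  intro h
  have h_zero := congrArg (fun v : Model d => v 0) h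
  simp [direction_zero] at h_zero

/-- The inclusion `w ↦ (0, w₁, …, w_d)`, which is the derivative of `direction s`. -/
def consZero : EuclideanSpace ℝ (Fin d) →L[ℝ] Model d :=
  LinearMap.toContinuousLinearMap
    { toFun := fun w => WithLp.toLp 2 (Fin.cons 0 w)
      map_add' := fun w w' => by ext i; cases i using Fin.cases <;> simp
      map_smul' := fun c w => by ext i; cases i using Fin.cases <;> simp }

/-- The projection `v ↦ (v₁, …, v_d)`. -/
def tail : Model d →L[ℝ] EuclideanSpace ℝ (Fin d) :=
  LinearMap.toContinuousLinearMap
    { toFun := fun v => WithLp.toLp 2 fun i => v i.succ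
      map_add' := fun v v' => by ext i; simp
      map_smul' := fun c v => by ext i; simp }

@[simp] lemma consZero_zero_apply (w : EuclideanSpace ℝ (Fin d)) : consZero w 0 = 0 := rfl

@[simp] lemma tail_consZero (w : EuclideanSpace ℝ (Fin d)) : tail (consZero w) = w := rfl

@[simp] lemma tail_single_zero (c : ℝ) : tail (EuclideanSpace.single 0 c : Model d) = 0 := by
  ext i
  simp [tail]

lemma direction_eq_add_consZero (s : ℤˣ) (w : EuclideanSpace ℝ (Fin d)) :
    direction s w = direction s 0 + consZero w := by
  ext i
  cases i using Fin.cases <;> simp [direction, consZero]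

lemma hasFDerivAt_direction (s : ℤˣ) (w : EuclideanSpace ℝ (Fin d)) :
    HasFDerivAt (direction s) consZero w := by
  rw [funext (direction_eq_add_consZero s)]
  exact consZero.hasFDerivAt.const_add _

lemma contDiff_direction (s : ℤˣ) {m : WithTop ℕ∞} : ContDiff ℝ m (direction (d := d) s) := by
  rw [funext (direction_eq_add_consZero s)]
  exact contDiff_const.add consZero.contDiff

lemma exists_eq_smul_direction {v : Model d} (hv : v 0 ≠ 0) :
    ∃ (s : ℤˣ) (t : ℝ) (w : EuclideanSpace ℝ (Fin d)), 0 < t ∧ v = t • direction s w := by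
  obtain ⟨s, hs⟩ : ∃ s : ℤˣ, v 0 = |v 0| * ((s : ℤ) : ℝ) := by
    rcases lt_or_gt_of_ne hv with h | h
    · exact ⟨-1, by simp [abs_of_neg h]⟩
    · exact ⟨1, by simp [abs_of_pos h]⟩
  refine ⟨s, |v 0|, |v 0|⁻¹ • tail v, abs_pos.2 hv, ?_⟩
  ext i
  cases i using Fin.cases with
  | zero => simpa [direction_zero] using hs
  | succ k => simp [direction_succ, tail, hv]

lemma direction_eq_of_eq_smul {s s' : ℤˣ} {w w' : EuclideanSpace ℝ (Fin d)} {t : ℝ} (ht : 0 < t)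
    (h : direction s w = t • direction s' w') : s = s' ∧ w = w' := by
  have h_zero : ((s : ℤ) : ℝ) = t * ((s' : ℤ) : ℝ) := congrArg (fun v : Model d => v 0) h
  have ht_one : t = 1 := by
    rcases Int.units_eq_one_or s with rfl | rfl <;>
      rcases Int.units_eq_one_or s' with rfl | rfl <;> norm_num at h_zero <;> linarith
  rw [ht_one, one_smul] at h
  refine ⟨Units.ext (by simpa [ht_one] using h_zero), ?_⟩
  ext k
  exact congrArg (fun v : Model d => v k.succ) h

end Directions

section CoordinateFrame

variable {d : ℕ}

variable (d) in
/-- The contact form `dy₀ + w₁ dy₁ + ⋯ + w_d dy_d`; it is a reference for the volume form of an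
arbitrary Hilbert form. -/
def stdContactForm : HCoord d → HCoord d →L[ℝ] ℝ :=
  covectorForm fun p => direction 1 p.2

variable (d) in
/-- The value of `α ∧ dαᵈ` on the coordinate frame at the origin, for the standard contact form
`α`. -/
def wedgeConst : ℝ :=
  wedgePow (stdContactForm d 0) (dOneForm (stdContactForm d) 0) (coordFrame d)

lemma dOneForm_stdContactForm (p X Z : HCoord d) : dOneForm (stdContactForm d) p ![X, Z] =
    inner ℝ (consZero X.2) Z.1 - inner ℝ (consZero Z.2) X.1 := by
  have h_dir : HasFDerivAt (fun q : HCoord d => direction 1 q.2) _ p :=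
    (hasFDerivAt_direction 1 p.2).comp p hasFDerivAt_snd
  rw [stdContactForm, dOneForm_covectorForm h_dir.differentiableAt, h_dir.fderiv]
  rfl

lemma coordFrame_fst_eq_zero {x : Option (Fin d × Bool)} (hx : isFibreSlot x) :
    (coordFrame d x).1 = 0 := by
  rcases x with _ | ⟨i, _ | _⟩
  · simp [isFibreSlot] at hx
  · simp [isFibreSlot] at hx
  · rfl

lemma det_prodMap_adjoint_id (R : Model d →ₗ[ℝ] Model d) :
    LinearMap.det (R.adjoint.prodMap (LinearMap.id : EuclideanSpace ℝ (Fin d) →ₗ[ℝ] _)) =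
      LinearMap.det R := by
  let e := EuclideanSpace.basisFun (Fin (d + 1)) ℝ
  rw [LinearMap.det_prodMap, LinearMap.det_id, mul_one, ← LinearMap.det_toMatrix e.toBasis,
    LinearMap.toMatrix_adjoint, Matrix.det_conjTranspose, LinearMap.det_toMatrix, star_trivial]

/-- `(a, b)` differs from the standard pair by the pullback under `(y, w) ↦ (R† y, w)`, except for
the values of `b` on pairs of base vectors. -/
lemma wedgePow_coordFrame {a : HCoord d →L[ℝ] ℝ} {b : HCoord d [⋀^Fin 2]→L[ℝ] ℝ}
    {R : Model d →ₗ[ℝ] Model d} (h_one : ∀ u, a u = inner ℝ (R (EuclideanSpace.single 0 1)) u.1)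
    (h_two : ∀ w u, b ![(0, w), u] = inner ℝ (R (consZero w)) u.1) :
    wedgePow a b (coordFrame d) = LinearMap.det R * wedgeConst d := by
  let T : HCoord d →ₗ[ℝ] HCoord d := R.adjoint.prodMap LinearMap.id
  have h_dir : direction 1 (0 : EuclideanSpace ℝ (Fin d)) = EuclideanSpace.single 0 1 := by
    ext i
    cases i using Fin.cases <;> simp [direction]
  have h_fibre : ∀ x u, isFibreSlot x →
      b ![coordFrame d x, u] = inner ℝ (R (consZero (coordFrame d x).2)) u.1 := by
    intro x u hx
    rw [← h_two, ← coordFrame_fst_eq_zero hx]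
  have h_congr : wedgePow a b (coordFrame d) =
      wedgePow (stdContactForm d 0) (dOneForm (stdContactForm d) 0) (T ∘ coordFrame d) := by
    refine wedgePow_congr_of_isFibreSlot (fun x => ?_) (fun x y hx => ?_) (fun x hx => ?_)
      (fun x y hx hy => ?_)
    · simp [h_one, stdContactForm, covectorForm, T, h_dir, LinearMap.adjoint_inner_right]
    · simp [h_fibre x _ hx, dOneForm_stdContactForm, T, LinearMap.adjoint_inner_right,
        coordFrame_fst_eq_zero hx]
    · simp [h_one, coordFrame_fst_eq_zero hx]
    · simp [h_fibre x _ hx, coordFrame_fst_eq_zero hy]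
  rw [h_congr, wedgePow_map (by simp; ring), det_prodMap_adjoint_id, wedgeConst]

end CoordinateFrame

/-- Minkowski norms: the restrictions of Finsler metrics to tangent spaces. -/
structure IsMinkowskiNorm {E : Type*} [NormedAddCommGroup E] [NormedSpace ℝ E] (φ : E → ℝ) :
    Prop where
  contDiffAt : ∀ v, v ≠ 0 → ContDiffAt ℝ ∞ φ v
  map_zero : φ 0 = 0
  pos : ∀ v, v ≠ 0 → 0 < φ v
  homogeneous : ∀ (v : E) (t : ℝ), 0 < t → φ (t • v) = t * φ v
  hessian_pos : ∀ v u : E, v ≠ 0 → u ≠ 0 → 0 < fderiv ℝ (fderiv ℝ fun w => φ w ^ 2) v u u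

lemma add_deriv_lt_of_second_deriv_pos {h h' h'' : ℝ → ℝ}
    (h_deriv : ∀ t ∈ Icc (0 : ℝ) 1, HasDerivAt h (h' t) t)
    (h_deriv' : ∀ t ∈ Icc (0 : ℝ) 1, HasDerivAt h' (h'' t) t)
    (h_pos : ∀ t ∈ Icc (0 : ℝ) 1, 0 < h'' t) : h 0 + h' 0 < h 1 := by
  obtain ⟨c, hc, hc_slope⟩ := exists_hasDerivAt_eq_slope h h' one_pos
    (fun t ht => (h_deriv t ht).continuousAt.continuousWithinAt)
    (fun t ht => h_deriv t (Ioo_subset_Icc_self ht))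
  have h_sub : Icc 0 c ⊆ Icc (0 : ℝ) 1 := Icc_subset_Icc le_rfl hc.2.le
  obtain ⟨e, he, he_slope⟩ := exists_hasDerivAt_eq_slope h' h'' hc.1
    (fun t ht => (h_deriv' t (h_sub ht)).continuousAt.continuousWithinAt)
    (fun t ht => h_deriv' t (h_sub (Ioo_subset_Icc_self ht)))
  have he_pos := h_pos e (h_sub (Ioo_subset_Icc_self he))
  rw [he_slope, sub_zero, div_pos_iff_of_pos_right hc.1] at he_pos
  rw [sub_zero, div_one] at hc_slope
  linarith

namespace IsMinkowskiNorm

section NormedSpace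

variable {E : Type*} [NormedAddCommGroup E] [NormedSpace ℝ E] {φ : E → ℝ}
  (hφ : IsMinkowskiNorm φ)

include hφ

lemma nonneg (v : E) : 0 ≤ φ v := by
  rcases eq_or_ne v 0 with rfl | hv
  · exact hφ.map_zero.ge
  · exact (hφ.pos v hv).le

lemma ne_zero_of_eq_one {v : E} (hv : φ v = 1) : v ≠ 0 := by
  rintro rfl
  exact zero_ne_one (hφ.map_zero.symm.trans hv)

lemma map_inv_smul_self {v : E} (hv : v ≠ 0) : φ ((φ v)⁻¹ • v) = 1 := by
  rw [hφ.homogeneous _ _ (inv_pos.2 (hφ.pos v hv)), inv_mul_cancel₀ (hφ.pos v hv).ne']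

lemma differentiableAt {v : E} (hv : v ≠ 0) : DifferentiableAt ℝ φ v :=
  (hφ.contDiffAt v hv).differentiableAt (by simp)

lemma fderiv_self {v : E} (hv : v ≠ 0) : fderiv ℝ φ v v = φ v := by
  have h_line : HasDerivAt (fun t : ℝ => t • v) v 1 := by
    simpa using (hasDerivAt_id (1 : ℝ)).smul_const v
  have h_chain : HasDerivAt (fun t : ℝ => φ (t • v)) (fderiv ℝ φ v v) 1 :=
    (by simpa using (hφ.differentiableAt hv).hasFDerivAt :
      HasFDerivAt φ (fderiv ℝ φ v) ((1 : ℝ) • v)).comp_hasDerivAt 1 h_line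
  have h_homog : (fun t : ℝ => φ (t • v)) =ᶠ[nhds 1] fun t => t * φ v := by
    filter_upwards [lt_mem_nhds one_pos] with t ht using hφ.homogeneous v t ht
  exact (h_chain.congr_of_eventuallyEq h_homog.symm).unique
    (by simpa using (hasDerivAt_id (1 : ℝ)).mul_const (φ v))

lemma fderiv_smul {v : E} (hv : v ≠ 0) {t : ℝ} (ht : 0 < t) :
    fderiv ℝ φ (t • v) = fderiv ℝ φ v := by
  have h := fderiv_comp_smul (𝕜 := ℝ) (f := φ) (x := v) t
  rw [show (fun x => φ (t • x)) = fun x => t • φ x from funext fun x => hφ.homogeneous x t ht,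
    fderiv_fun_const_smul (hφ.differentiableAt hv)] at h
  exact (smul_right_injective _ ht.ne' h).symm

/-- Strict convexity of `φ²` along the segment. -/
lemma fderiv_lt_of_notMem_segment {v u : E} (huv : u ≠ v) (h_seg : (0 : E) ∉ segment ℝ v u)
    (h_eq : φ u = φ v) : fderiv ℝ φ v u < φ u := by
  let g : E → ℝ := fun w => φ w ^ 2
  let γ : ℝ → E := fun t => v + t • (u - v)
  have hγ : ∀ t ∈ Icc (0 : ℝ) 1, γ t ≠ 0 := fun t ht h =>
    h_seg (segment_eq_image' ℝ v u ▸ ⟨t, ht, h⟩)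
  have hγ_deriv : ∀ t, HasDerivAt γ (u - v) t := fun t => by
    simpa [γ] using ((hasDerivAt_id t).smul_const (u - v)).const_add v
  have hg : ∀ t ∈ Icc (0 : ℝ) 1, ContDiffAt ℝ ∞ g (γ t) := fun t ht =>
    (hφ.contDiffAt _ (hγ t ht)).pow 2
  have h_deriv : ∀ t ∈ Icc (0 : ℝ) 1, HasDerivAt (g ∘ γ) (fderiv ℝ g (γ t) (u - v)) t :=
    fun t ht => ((hg t ht).differentiableAt (by simp)).hasFDerivAt.comp_hasDerivAt t (hγ_deriv t)
  have h_deriv' : ∀ t ∈ Icc (0 : ℝ) 1, HasDerivAt (fun t => fderiv ℝ g (γ t) (u - v))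
      (fderiv ℝ (fderiv ℝ g) (γ t) (u - v) (u - v)) t := fun t ht => by
    have h_fderiv : ContDiffAt ℝ 1 (fderiv ℝ g) (γ t) := (hg t ht).fderiv_right (by norm_cast)
    simpa using ((h_fderiv.differentiableAt (by simp)).hasFDerivAt.comp_hasDerivAt t
      (hγ_deriv t)).clm_apply (hasDerivAt_const t (u - v))
  have h_lt := add_deriv_lt_of_second_deriv_pos h_deriv h_deriv'
    fun t ht => hφ.hessian_pos _ _ (hγ t ht) (sub_ne_zero.2 huv)
  have hv : v ≠ 0 := by simpa [γ] using hγ 0 (by simp)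
  have hg_fderiv : fderiv ℝ g v = (2 * φ v) • fderiv ℝ φ v := by
    simpa using ((hφ.differentiableAt hv).hasFDerivAt.pow 2).fderiv
  simp only [Function.comp_apply, γ, zero_smul, add_zero, one_smul, add_sub_cancel, hg_fderiv,
    smul_apply, map_sub, hφ.fderiv_self hv, smul_eq_mul, g, h_eq] at h_lt
  rw [h_eq]
  nlinarith [hφ.pos v hv]

lemma fderiv_nonpos_of_mem_segment {v u : E} (hv : v ≠ 0) (h_seg : (0 : E) ∈ segment ℝ v u) :
    fderiv ℝ φ v u ≤ 0 := by
  obtain ⟨a, b, ha, hb, hab, h_zero⟩ := h_seg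
  have h_apply := congrArg (fderiv ℝ φ v) h_zero
  simp only [map_add, map_smul, hφ.fderiv_self hv, smul_eq_mul, _root_.map_zero] at h_apply
  rcases hb.eq_or_lt with rfl | hb
  · simp_all
  · nlinarith [mul_nonneg ha (hφ.nonneg v)]

lemma fderiv_lt_of_eq {v u : E} (hv : v ≠ 0) (huv : u ≠ v) (h_eq : φ u = φ v) :
    fderiv ℝ φ v u < φ u := by
  by_cases h_seg : (0 : E) ∈ segment ℝ v u
  · exact (hφ.fderiv_nonpos_of_mem_segment hv h_seg).trans_lt (h_eq ▸ hφ.pos v hv)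
  · exact hφ.fderiv_lt_of_notMem_segment huv h_seg h_eq

/-- The fundamental inequality of Finsler geometry. -/
lemma fderiv_le {v : E} (hv : v ≠ 0) (u : E) : fderiv ℝ φ v u ≤ φ u := by
  rcases eq_or_ne u 0 with rfl | hu
  · simp [hφ.map_zero]
  have hr : 0 < φ v / φ u := div_pos (hφ.pos v hv) (hφ.pos u hu)
  have h_eq : φ ((φ v / φ u) • u) = φ v := by
    rw [hφ.homogeneous _ _ hr, div_mul_cancel₀ _ (hφ.pos u hu).ne']
  suffices h : fderiv ℝ φ v ((φ v / φ u) • u) ≤ φ ((φ v / φ u) • u) by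
    rw [hφ.homogeneous _ _ hr, map_smul, smul_eq_mul] at h
    exact le_of_mul_le_mul_left h hr
  by_cases huv : (φ v / φ u) • u = v
  · rw [huv, hφ.fderiv_self hv]
  · exact (hφ.fderiv_lt_of_eq hv huv h_eq).le

lemma eq_of_fderiv_eq {v u : E} (hv : φ v = 1) (hu : φ u = 1) (h : fderiv ℝ φ v = fderiv ℝ φ u) :
    v = u := by
  by_contra! huv
  have h_lt := hφ.fderiv_lt_of_eq (hφ.ne_zero_of_eq_one hv) huv.symm (hu.trans hv.symm)
  rw [h, hφ.fderiv_self (hφ.ne_zero_of_eq_one hu)] at h_lt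
  exact lt_irrefl _ h_lt

lemma one_le_of_map_neg_le [Nontrivial E] {c : ℝ} (hc : ∀ v, φ (-v) ≤ c * φ v) : 1 ≤ c := by
  obtain ⟨v, hv⟩ := exists_ne (0 : E)
  have h_neg := hc (-v)
  rw [neg_neg] at h_neg
  by_contra! h
  nlinarith [hc v, hφ.pos v hv, hφ.pos (-v) (neg_ne_zero.2 hv)]

end NormedSpace

end IsMinkowskiNorm

section DualNorm

variable {E : Type*} [NormedAddCommGroup E] [InnerProductSpace ℝ E]

/-- The norm dual to `φ`, on vectors identified with covectors by the inner product. -/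
def dualNorm (φ : E → ℝ) (ξ : E) : ℝ :=
  sSup ((fun v => inner ℝ ξ v / φ v) '' Metric.sphere 0 1)

/-- The unit ball of the dual norm. -/
def dualBall (φ : E → ℝ) : Set E := {ξ | ∀ v, inner ℝ ξ v ≤ φ v}

/-- The vector `v` of norm `φ v = 1` at which the covector `ξ ≠ 0` attains its dual norm. For a
Finsler metric, the Reeb field at the covector `ξ` of norm `1` lies over `v`. -/
def dualVector (φ : E → ℝ) (ξ : E) : E :=
  Classical.epsilon fun v => φ v = 1 ∧ inner ℝ ξ v = dualNorm φ ξ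

lemma isClosed_dualBall (φ : E → ℝ) : IsClosed (dualBall φ) := by
  rw [dualBall, ofPred_forall]
  exact isClosed_iInter fun v => isClosed_le (by fun_prop) continuous_const

namespace IsMinkowskiNorm

variable [FiniteDimensional ℝ E] [Nontrivial E] {φ : E → ℝ} (hφ : IsMinkowskiNorm φ)

include hφ

lemma exists_dualNorm_eq (ξ : E) :
    ∃ v, v ≠ 0 ∧ dualNorm φ ξ = inner ℝ ξ v / φ v ∧
      ∀ u ∈ Metric.sphere (0 : E) 1, inner ℝ ξ u / φ u ≤ dualNorm φ ξ := by
  have h_ne : ∀ v ∈ Metric.sphere (0 : E) 1, v ≠ 0 := fun v hv =>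
    ne_zero_of_mem_unit_sphere ⟨v, hv⟩
  have h_cont : ContinuousOn (fun v => inner ℝ ξ v / φ v) (Metric.sphere 0 1) :=
    ContinuousOn.div (by fun_prop)
      (fun v hv => (hφ.contDiffAt v (h_ne v hv)).continuousAt.continuousWithinAt)
      fun v hv => (hφ.pos v (h_ne v hv)).ne'
  obtain ⟨v, hv, h_sup, h_max⟩ := (isCompact_sphere (0 : E) 1).exists_sSup_image_eq_and_ge
    (NormedSpace.sphere_nonempty.2 zero_le_one) h_cont
  exact ⟨v, h_ne v hv, h_sup, fun u hu => (h_max u hu).trans_eq h_sup.symm⟩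

lemma inner_le (ξ v : E) : inner ℝ ξ v ≤ dualNorm φ ξ * φ v := by
  rcases eq_or_ne v 0 with rfl | hv
  · simp [hφ.map_zero]
  obtain ⟨-, -, -, h_max⟩ := hφ.exists_dualNorm_eq ξ
  have h := h_max (‖v‖⁻¹ • v) (by simp [norm_smul, hv])
  have h_norm : 0 < ‖v‖⁻¹ := inv_pos.2 (norm_pos_iff.2 hv)
  rwa [hφ.homogeneous _ _ h_norm, inner_smul_right, mul_div_mul_left _ _ h_norm.ne',
    div_le_iff₀ (hφ.pos v hv)] at h

lemma dualVector_spec (ξ : E) :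
    φ (dualVector φ ξ) = 1 ∧ inner ℝ ξ (dualVector φ ξ) = dualNorm φ ξ := by
  obtain ⟨v, hv, h_eq, -⟩ := hφ.exists_dualNorm_eq ξ
  refine Classical.epsilon_spec (p := fun v => φ v = 1 ∧ inner ℝ ξ v = dualNorm φ ξ)
    ⟨(φ v)⁻¹ • v, hφ.map_inv_smul_self hv, ?_⟩
  rw [inner_smul_right, h_eq, inv_mul_eq_div]

lemma dualNorm_le {ξ : E} {r : ℝ} (h : ∀ v, inner ℝ ξ v ≤ r * φ v) : dualNorm φ ξ ≤ r := by
  obtain ⟨h_one, h_eq⟩ := hφ.dualVector_spec ξ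
  simpa [← h_eq, h_one] using h (dualVector φ ξ)

lemma mem_dualBall_iff {ξ : E} : ξ ∈ dualBall φ ↔ dualNorm φ ξ ≤ 1 :=
  ⟨fun h => hφ.dualNorm_le fun v => by simpa using h v,
    fun h v => (hφ.inner_le ξ v).trans (mul_le_of_le_one_left (hφ.nonneg v) h)⟩

lemma dualNorm_add_le (ξ ζ : E) : dualNorm φ (ξ + ζ) ≤ dualNorm φ ξ + dualNorm φ ζ :=
  hφ.dualNorm_le fun v => by
    rw [inner_add_left, add_mul]
    exact add_le_add (hφ.inner_le ξ v) (hφ.inner_le ζ v)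

lemma dualNorm_smul (ξ : E) {t : ℝ} (ht : 0 < t) : dualNorm φ (t • ξ) = t * dualNorm φ ξ := by
  have h_le : ∀ (ξ : E) {t : ℝ}, 0 < t → dualNorm φ (t • ξ) ≤ t * dualNorm φ ξ := by
    intro ξ t ht
    refine hφ.dualNorm_le fun v => ?_
    rw [real_inner_smul_left, mul_assoc]
    exact mul_le_mul_of_nonneg_left (hφ.inner_le ξ v) ht.le
  refine (h_le ξ ht).antisymm ?_
  have h_inv := h_le (t • ξ) (inv_pos.2 ht)
  rwa [inv_smul_smul₀ ht.ne', le_inv_mul_iff₀ ht] at h_inv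

lemma dualNorm_nonneg (ξ : E) : 0 ≤ dualNorm φ ξ := by
  by_contra! h
  have h_self := hφ.inner_le ξ ξ
  have hξ : ξ = 0 := by
    rw [← real_inner_self_nonpos]
    exact h_self.trans (mul_nonpos_of_nonpos_of_nonneg h.le (hφ.nonneg ξ))
  have h_eq := (hφ.dualVector_spec ξ).2
  rw [hξ, inner_zero_left] at h_eq
  exact h.ne (hξ ▸ h_eq.symm)

lemma neg_inner_le {c : ℝ} (hc : ∀ v, φ (-v) ≤ c * φ v) (ξ v : E) :
    -inner ℝ ξ v ≤ c * dualNorm φ ξ * φ v :=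
  calc -inner ℝ ξ v = inner ℝ ξ (-v) := (inner_neg_right _ _).symm
    _ ≤ dualNorm φ ξ * φ (-v) := hφ.inner_le ξ (-v)
    _ ≤ dualNorm φ ξ * (c * φ v) := mul_le_mul_of_nonneg_left (hc v) (hφ.dualNorm_nonneg ξ)
    _ = c * dualNorm φ ξ * φ v := by ring

lemma dualNorm_neg_le {c : ℝ} (hc : ∀ v, φ (-v) ≤ c * φ v) (ξ : E) :
    dualNorm φ (-ξ) ≤ c * dualNorm φ ξ :=
  hφ.dualNorm_le fun v => (inner_neg_left (𝕜 := ℝ) ξ v).trans_le (hφ.neg_inner_le hc ξ v)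

lemma dualNorm_gradient {v : E} (hv : v ≠ 0) : dualNorm φ (∇ φ v) = 1 := by
  refine (hφ.dualNorm_le fun u => ?_).antisymm ?_
  · rw [inner_gradient_left, one_mul]
    exact hφ.fderiv_le hv u
  · have h := hφ.inner_le (∇ φ v) v
    rw [inner_gradient_left, hφ.fderiv_self hv] at h
    exact (le_mul_iff_one_le_left (hφ.pos v hv)).1 h

/-- The Lagrange multiplier rule for the maximum of `ξ` on the unit sphere of `φ`. -/
lemma dualNorm_smul_gradient_dualVector (ξ : E) :
    dualNorm φ ξ • ∇ φ (dualVector φ ξ) = ξ := by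
  obtain ⟨h_one, h_eq⟩ := hφ.dualVector_spec ξ
  have h_min : IsLocalMin (fun u => dualNorm φ ξ * φ u - innerSL ℝ ξ u) (dualVector φ ξ) :=
    Filter.Eventually.of_forall fun u => by
      simpa [h_eq, h_one] using hφ.inner_le ξ u
  have h_deriv := ((hφ.differentiableAt (hφ.ne_zero_of_eq_one h_one)).hasFDerivAt.const_mul
    (dualNorm φ ξ)).sub (innerSL ℝ ξ).hasFDerivAt
  have h_zero := h_min.hasFDerivAt_eq_zero h_deriv
  refine ext_inner_right ℝ fun u => ?_
  have h_apply := DFunLike.congr_fun h_zero u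
  rw [real_inner_smul_left, inner_gradient_left]
  exact sub_eq_zero.1 h_apply

lemma dualVector_smul_gradient {v : E} (hv : v ≠ 0) {t : ℝ} (ht : 0 < t) :
    dualVector φ (t • ∇ φ v) = (φ v)⁻¹ • v := by
  have h_eq := hφ.dualNorm_smul_gradient_dualVector (t • ∇ φ v)
  rw [hφ.dualNorm_smul _ ht, hφ.dualNorm_gradient hv, mul_one] at h_eq
  refine hφ.eq_of_fderiv_eq (hφ.dualVector_spec _).1 (hφ.map_inv_smul_self hv) ?_
  rw [hφ.fderiv_smul hv (inv_pos.2 (hφ.pos v hv)), ← toDual_gradient, ← toDual_gradient,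
    smul_right_injective _ ht.ne' h_eq]

lemma one_quarter_le_inner_dualVector {c : ℝ} (hc : ∀ v, φ (-v) ≤ c * φ v) {η ζ : E}
    (hη : dualNorm φ η = 1 / 2) (hζ : ζ ∈ dualBall φ) :
    1 / 4 ≤ inner ℝ η (dualVector φ (η + (8 * c)⁻¹ • ζ)) := by
  have hc_one := hφ.one_le_of_map_neg_le hc
  have hε : 0 < (8 * c)⁻¹ := by positivity
  have hε_c : (8 * c)⁻¹ * c = 1 / 8 := by field_simp
  have hζ_one := hφ.mem_dualBall_iff.1 hζ
  obtain ⟨h_one, h_eq⟩ := hφ.dualVector_spec (η + (8 * c)⁻¹ • ζ)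
  have h_inner : inner ℝ ζ (dualVector φ (η + (8 * c)⁻¹ • ζ)) ≤ 1 :=
    (hζ _).trans_eq h_one
  have h_norm := hφ.dualNorm_add_le (η + (8 * c)⁻¹ • ζ) ((8 * c)⁻¹ • -ζ)
  rw [smul_neg, add_neg_cancel_right, ← smul_neg, hφ.dualNorm_smul _ hε, hη] at h_norm
  rw [inner_add_left, real_inner_smul_left] at h_eq
  have h_neg := hφ.dualNorm_neg_le hc ζ
  nlinarith

variable {φ₀ : E → ℝ} (hφ₀ : IsMinkowskiNorm φ₀)

include hφ₀

lemma dualNorm_le_mul {C : ℝ} (h : ∀ v, φ₀ v ≤ C * φ v) (ξ : E) :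
    dualNorm φ ξ ≤ C * dualNorm φ₀ ξ :=
  hφ.dualNorm_le fun v =>
    calc inner ℝ ξ v ≤ dualNorm φ₀ ξ * φ₀ v := hφ₀.inner_le ξ v
      _ ≤ dualNorm φ₀ ξ * (C * φ v) := mul_le_mul_of_nonneg_left (h v) (hφ₀.dualNorm_nonneg ξ)
      _ = C * dualNorm φ₀ ξ * φ v := by ring

end IsMinkowskiNorm

end DualNorm

section DualEnergy

variable {E : Type*} [NormedAddCommGroup E] [InnerProductSpace ℝ E] [MeasureSpace E]

/-- The energy of the covector `η` with respect to `φ`: the integral of `⟪η, v⟫²` over the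
covectors `ξ` in the dual ball, with `v` the vector dual to `ξ`. -/
def dualEnergy (φ : E → ℝ) (η : E) : ℝ≥0∞ :=
  ∫⁻ ξ in dualBall φ, ENNReal.ofReal (inner ℝ η (dualVector φ ξ) ^ 2)

lemma volume_dualBall_le [FiniteDimensional ℝ E] [BorelSpace E]
    [(volume : Measure E).IsAddHaarMeasure] {φ φ₀ : E → ℝ} {C : ℝ} (hC : 0 < C)
    (h : ∀ v, φ v ≤ C * φ₀ v) :
    volume (dualBall φ) ≤ ENNReal.ofReal (C ^ Module.finrank ℝ E) * volume (dualBall φ₀) := by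
  have h_sub : dualBall φ ⊆ C • dualBall φ₀ := fun ξ hξ => by
    rw [mem_smul_set_iff_inv_smul_mem₀ hC.ne']
    intro v
    rw [real_inner_smul_left, inv_mul_le_iff₀ hC]
    exact (hξ v).trans (h v)
  refine (measure_mono h_sub).trans_eq ?_
  rw [Measure.addHaar_smul, abs_of_pos (by positivity)]

namespace IsMinkowskiNorm

variable [FiniteDimensional ℝ E] [Nontrivial E] {φ : E → ℝ} (hφ : IsMinkowskiNorm φ)

include hφ

lemma dualEnergy_le {c : ℝ} (hc : ∀ v, φ (-v) ≤ c * φ v) (η : E) :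
    dualEnergy φ η ≤ ENNReal.ofReal ((c * dualNorm φ η) ^ 2) * volume (dualBall φ) := by
  have hc_one := hφ.one_le_of_map_neg_le hc
  have h_nonneg := hφ.dualNorm_nonneg η
  have h_le : ∀ ξ, inner ℝ η (dualVector φ ξ) ^ 2 ≤ (c * dualNorm φ η) ^ 2 := by
    intro ξ
    have h_one := (hφ.dualVector_spec ξ).1
    have h_upper := hφ.inner_le η (dualVector φ ξ)
    have h_lower := hφ.neg_inner_le hc η (dualVector φ ξ)
    rw [h_one, mul_one] at h_upper h_lower
    exact sq_le_sq' (by linarith) (by nlinarith)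
  rw [← setLIntegral_const]
  exact lintegral_mono fun ξ => ENNReal.ofReal_le_ofReal (h_le ξ)

lemma le_dualEnergy [BorelSpace E] [(volume : Measure E).IsAddHaarMeasure] {c : ℝ}
    (hc : ∀ v, φ (-v) ≤ c * φ v) (η : E) :
    ENNReal.ofReal ((dualNorm φ η / 2) ^ 2) *
      (ENNReal.ofReal ((8 * c)⁻¹ ^ Module.finrank ℝ E) * volume (dualBall φ)) ≤
        dualEnergy φ η := by
  rcases (hφ.dualNorm_nonneg η).eq_or_lt with h_zero | hη
  · simp [← h_zero]
  have hc_one := hφ.one_le_of_map_neg_le hc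
  set ε := (8 * c)⁻¹ with hε_def
  have hε : 0 < ε := by positivity
  have hε_le : ε ≤ 1 / 8 := by
    rw [hε_def, inv_le_comm₀ (by positivity) (by norm_num)]
    linarith
  let N := dualNorm φ η
  let η' := (2 * N)⁻¹ • η
  have hη' : dualNorm φ η' = 1 / 2 := by
    rw [hφ.dualNorm_smul _ (by positivity), mul_inv, mul_assoc, inv_mul_cancel₀ hη.ne']
    norm_num
  let U := η' +ᵥ ε • dualBall φ
  have hU_volume : volume U = ENNReal.ofReal (ε ^ Module.finrank ℝ E) * volume (dualBall φ) := by
    rw [measure_vadd, Measure.addHaar_smul, abs_of_pos (by positivity)]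
  have hU_sub : U ⊆ dualBall φ := by
    rintro _ ⟨_, ⟨ζ, hζ, rfl⟩, rfl⟩
    have h_norm := hφ.dualNorm_add_le η' (ε • ζ)
    rw [hη', hφ.dualNorm_smul _ hε] at h_norm
    refine hφ.mem_dualBall_iff.2 (h_norm.trans ?_)
    nlinarith [hφ.mem_dualBall_iff.1 hζ]
  have hU_inner : ∀ ξ ∈ U, (N / 2) ^ 2 ≤ inner ℝ η (dualVector φ ξ) ^ 2 := by
    rintro _ ⟨_, ⟨ζ, hζ, rfl⟩, rfl⟩
    have h_quarter := hφ.one_quarter_le_inner_dualVector hc hη' hζ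
    rw [real_inner_smul_left, le_inv_mul_iff₀ (by positivity)] at h_quarter
    exact pow_le_pow_left₀ (by positivity) (by simpa [N] using by linarith) 2
  calc ENNReal.ofReal ((N / 2) ^ 2) *
        (ENNReal.ofReal (ε ^ Module.finrank ℝ E) * volume (dualBall φ))
      = ∫⁻ _ in U, ENNReal.ofReal ((N / 2) ^ 2) := by rw [setLIntegral_const, hU_volume]
    _ ≤ ∫⁻ ξ in U, ENNReal.ofReal (inner ℝ η (dualVector φ ξ) ^ 2) :=
        setLIntegral_mono' (((isClosed_dualBall φ).measurableSet.const_smul₀ ε).const_vadd η')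
          fun ξ hξ => ENNReal.ofReal_le_ofReal (hU_inner ξ hξ)
    _ ≤ dualEnergy φ η := lintegral_mono_set hU_sub

variable [BorelSpace E] [(volume : Measure E).IsAddHaarMeasure] {φ₀ : E → ℝ}
  (hφ₀ : IsMinkowskiNorm φ₀)

include hφ₀

lemma dualEnergy_le_mul {c C : ℝ} (hC : 0 < C) (hc : ∀ v, φ (-v) ≤ c * φ v)
    (hc₀ : ∀ v, φ₀ (-v) ≤ c * φ₀ v) (h_le : ∀ v, φ v ≤ C * φ₀ v) (h_ge : ∀ v, φ₀ v ≤ C * φ v)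
    (η : E) :
    dualEnergy φ η ≤
      ENNReal.ofReal ((2 * c * C) ^ 2 * (8 * c * C) ^ Module.finrank ℝ E) * dualEnergy φ₀ η := by
  have hc_one := hφ.one_le_of_map_neg_le hc
  have hN : (c * dualNorm φ η) ^ 2 ≤ (2 * c * C) ^ 2 * (dualNorm φ₀ η / 2) ^ 2 := by
    have h_nonneg := hφ.dualNorm_nonneg η
    calc (c * dualNorm φ η) ^ 2 ≤ (c * (C * dualNorm φ₀ η)) ^ 2 := by
          gcongr
          exact hφ.dualNorm_le_mul hφ₀ h_ge η
      _ = (2 * c * C) ^ 2 * (dualNorm φ₀ η / 2) ^ 2 := by ring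
  have h_pow : C ^ Module.finrank ℝ E =
      (8 * c * C) ^ Module.finrank ℝ E * (8 * c)⁻¹ ^ Module.finrank ℝ E := by
    rw [← mul_pow]
    congr 1
    field_simp
  calc dualEnergy φ η
      ≤ ENNReal.ofReal ((c * dualNorm φ η) ^ 2) * volume (dualBall φ) := hφ.dualEnergy_le hc η
    _ ≤ ENNReal.ofReal ((2 * c * C) ^ 2 * (dualNorm φ₀ η / 2) ^ 2) *
        (ENNReal.ofReal (C ^ Module.finrank ℝ E) * volume (dualBall φ₀)) :=
      mul_le_mul' (ENNReal.ofReal_le_ofReal hN) (volume_dualBall_le hC h_le)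
    _ = ENNReal.ofReal ((2 * c * C) ^ 2 * (8 * c * C) ^ Module.finrank ℝ E) *
        (ENNReal.ofReal ((dualNorm φ₀ η / 2) ^ 2) *
          (ENNReal.ofReal ((8 * c)⁻¹ ^ Module.finrank ℝ E) * volume (dualBall φ₀))) := by
      rw [h_pow, ENNReal.ofReal_mul (by positivity), ENNReal.ofReal_mul (by positivity),
        ENNReal.ofReal_mul (by positivity)]
      ring
    _ ≤ _ := mul_le_mul_right (hφ₀.le_dualEnergy hc₀ η) _

end IsMinkowskiNorm

end DualEnergy

section PolarCoordinates

variable {d : ℕ}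

/-- The covector that the Hilbert form of `φ` attaches to `direction s w`, as a vector of the
Euclidean model space. -/
def momentum (φ : Model d → ℝ) (s : ℤˣ) (w : EuclideanSpace ℝ (Fin d)) : Model d :=
  ∇ φ (direction s w)

/-- The linear map `x ↦ x₀ m(w) + x₁ ∂m/∂w₁ + ⋯ + x_d ∂m/∂w_d`. -/
def polarFrame (m : EuclideanSpace ℝ (Fin d) → Model d) (w : EuclideanSpace ℝ (Fin d)) :
    Model d →L[ℝ] Model d :=
  (EuclideanSpace.proj (𝕜 := ℝ) (0 : Fin (d + 1))).smulRight (m w) + (fderiv ℝ m w).comp tail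

/-- Polar coordinates `(r, w) ↦ r p(w)` on the space of covectors, with radius given by the dual
norm. -/
def polarMap (φ : Model d → ℝ) (s : ℤˣ) (x : Model d) : Model d :=
  x 0 • momentum φ s (tail x)

/-- The linear map `x ↦ (x₀, r x₁, …, r x_d)`. -/
def tailScaling (r : ℝ) : Model d →L[ℝ] Model d :=
  (EuclideanSpace.proj (𝕜 := ℝ) (0 : Fin (d + 1))).smulRight (EuclideanSpace.single 0 1) +
    r • consZero.comp tail

lemma polarFrame_apply (m : EuclideanSpace ℝ (Fin d) → Model d) (w : EuclideanSpace ℝ (Fin d))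
    (x : Model d) : polarFrame m w x = x 0 • m w + fderiv ℝ m w (tail x) :=
  rfl

lemma polarFrame_fibre {N : HCoord d → Model d} {p : HCoord d}
    (hN : DifferentiableAt ℝ N p) (x : Model d) :
    polarFrame (fun w => N (p.1, w)) p.2 x = x 0 • N p + fderiv ℝ N p (0, tail x) := by
  have h_fibre : HasFDerivAt (fun w => N (p.1, w)) _ p.2 :=
    hN.hasFDerivAt.comp p.2 (hasFDerivAt_prodMk_right p.1 p.2)
  simp [polarFrame_apply, h_fibre.fderiv]

lemma continuousOn_polarFrame_det {N : HCoord d → Model d} {U : Set (HCoord d)} (hU : IsOpen U)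
    (hN : ContDiffOn ℝ 1 N U) :
    ContinuousOn (fun p => (polarFrame (fun w => N (p.1, w)) p.2).det) U := by
  have h_frame : ContinuousOn (fun p => (ContinuousLinearMap.smulRightL ℝ (Model d) (Model d)
      (EuclideanSpace.proj 0) (N p) + (fderiv ℝ N p).comp
        ((ContinuousLinearMap.inr ℝ (Model d) (EuclideanSpace ℝ (Fin d))).comp tail))) U :=
    ((ContinuousLinearMap.smulRightL ℝ (Model d) (Model d)
      (EuclideanSpace.proj 0)).continuous.comp_continuousOn hN.continuousOn).add
      ((hN.continuousOn_fderiv_of_isOpen hU le_rfl).clm_comp continuousOn_const)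
  refine (ContinuousLinearMap.continuous_det.comp_continuousOn h_frame).congr fun p hp => ?_
  refine congrArg ContinuousLinearMap.det (ContinuousLinearMap.ext fun x => ?_)
  exact polarFrame_fibre ((hN.contDiffAt (hU.mem_nhds hp)).differentiableAt one_ne_zero) x

lemma polarFrame_tailScaling (m : EuclideanSpace ℝ (Fin d) → Model d)
    (w : EuclideanSpace ℝ (Fin d)) (r : ℝ) (u : Model d) :
    polarFrame m w (tailScaling r u) = r • fderiv ℝ m w (tail u) + u 0 • m w := by
  simp [polarFrame_apply, tailScaling, add_comm]

lemma det_tailScaling (r : ℝ) : (tailScaling r : Model d →L[ℝ] Model d).det = r ^ d := by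
  let e := (EuclideanSpace.basisFun (Fin (d + 1)) ℝ).toBasis
  have h : LinearMap.toMatrix e e (tailScaling r).toLinearMap =
      Matrix.diagonal (Fin.cons 1 fun _ => r) := by
    ext i j
    cases i using Fin.cases <;> cases j using Fin.cases <;>
      simp [e, LinearMap.toMatrix_apply, tailScaling, consZero, tail, Matrix.diagonal_apply,
        Fin.succ_ne_zero, (Fin.succ_ne_zero _).symm]
  rw [ContinuousLinearMap.det, ← LinearMap.det_toMatrix e, h, Matrix.det_diagonal,
    Fin.prod_univ_succ]
  simp

variable (d) in
/-- The slab `{0 < x₀ ≤ 1}`, the domain of polar coordinates on the dual ball. -/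
def slab : Set (Model d) := {x | x 0 ∈ Ioc (0 : ℝ) 1}

lemma measurableSet_slab : MeasurableSet (slab d) :=
  (EuclideanSpace.proj (𝕜 := ℝ) (0 : Fin (d + 1))).measurable measurableSet_Ioc

lemma measurePreserving_zero_tail :
    MeasurePreserving (fun x : Model d => (x 0, tail x)) volume volume := by
  have h_toPi := EuclideanSpace.volume_preserving_symm_measurableEquiv_toLp (Fin (d + 1))
  have h_split := volume_preserving_piFinSuccAbove (fun _ : Fin (d + 1) => ℝ) 0
  have h_ofPi := (EuclideanSpace.volume_preserving_symm_measurableEquiv_toLp (Fin d)).symm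
  exact ((MeasurePreserving.id (volume : Measure ℝ)).prod h_ofPi).comp (h_split.comp h_toPi)

lemma lintegral_Ioc_pow : ∫⁻ r in Ioc (0 : ℝ) 1, ENNReal.ofReal (r ^ d) = ((d : ℝ≥0∞) + 1)⁻¹ := by
  have h_nonneg : 0 ≤ᵐ[volume.restrict (Ioc (0 : ℝ) 1)] fun r => r ^ d := by
    filter_upwards [ae_restrict_mem measurableSet_Ioc] with r hr using pow_nonneg hr.1.le d
  have h_int : IntegrableOn (fun r : ℝ => r ^ d) (Ioc 0 1) :=
    (continuous_pow d).integrableOn_Ioc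
  rw [← ofReal_integral_eq_lintegral_ofReal h_int h_nonneg,
    ← intervalIntegral.integral_of_le zero_le_one, integral_pow, one_pow,
    zero_pow d.succ_ne_zero, sub_zero, one_div, ENNReal.ofReal_inv_of_pos (by positivity),
    ENNReal.ofReal_add (by positivity) zero_le_one]
  simp

lemma lintegral_slab {g : EuclideanSpace ℝ (Fin d) → ℝ≥0∞} (hg : Measurable g) :
    ∫⁻ x in slab d, ENNReal.ofReal (x 0 ^ d) * g (tail x) = ((d : ℝ≥0∞) + 1)⁻¹ * ∫⁻ w, g w := by
  have h_slab : slab d = (fun x : Model d => (x 0, tail x)) ⁻¹' (Ioc (0 : ℝ) 1 ×ˢ univ) := by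
    ext x
    simp [slab]
  have h_meas : Measurable fun q : ℝ × EuclideanSpace ℝ (Fin d) =>
      ENNReal.ofReal (q.1 ^ d) * g q.2 := by fun_prop
  rw [h_slab, measurePreserving_zero_tail.setLIntegral_comp_preimage
    (measurableSet_Ioc.prod MeasurableSet.univ) h_meas, Measure.volume_eq_prod,
    ← Measure.prod_restrict, Measure.restrict_univ, ← lintegral_Ioc_pow]
  exact lintegral_prod_mul (f := fun r : ℝ => ENNReal.ofReal (r ^ d)) (by fun_prop) hg.aemeasurable

lemma volume_equator : volume {v : Model d | v 0 = 0} = 0 := by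
  refine Measure.addHaar_submodule volume
    (LinearMap.ker (EuclideanSpace.proj (𝕜 := ℝ) (0 : Fin (d + 1))).toLinearMap) fun h => ?_
  have h_mem := h ▸ Submodule.mem_top (x := EuclideanSpace.single (0 : Fin (d + 1)) (1 : ℝ))
  simp at h_mem

/-- The density of `⟨η, X⟩²` times the contact measure at the direction of `(s, w)`, where `X` is
the `φ`-unit vector in that direction. -/
def fibreDensity (φ : Model d → ℝ) (η : Model d) (s : ℤˣ) (w : EuclideanSpace ℝ (Fin d)) : ℝ :=
  |(polarFrame (momentum φ s) w).det| *
    inner ℝ η ((φ (direction s w))⁻¹ • direction s w) ^ 2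

/-- The energy of the covector `η` with respect to `φ`, as an integral over the directions against
the contact measure. -/
def fibreEnergy (φ : Model d → ℝ) (η : Model d) : ℝ≥0∞ :=
  ∑ s : ℤˣ, ∫⁻ w, ENNReal.ofReal (fibreDensity φ η s w)

namespace IsMinkowskiNorm

variable {φ : Model d → ℝ} (hφ : IsMinkowskiNorm φ)

include hφ

lemma contDiffAt_gradient {v : Model d} (hv : v ≠ 0) : ContDiffAt ℝ ∞ (∇ φ) v :=
  (InnerProductSpace.toDual ℝ (Model d)).symm.contDiff.contDiffAt.comp v
    ((hφ.contDiffAt v hv).fderiv_right (by norm_cast))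

lemma contDiff_momentum (s : ℤˣ) : ContDiff ℝ ∞ (momentum φ s) :=
  contDiff_iff_contDiffAt.2 fun w =>
    (hφ.contDiffAt_gradient (direction_ne_zero s w)).comp w (contDiff_direction s).contDiffAt

lemma dualVector_momentum (s : ℤˣ) (w : EuclideanSpace ℝ (Fin d)) {t : ℝ} (ht : 0 < t) :
    dualVector φ (t • momentum φ s w) = (φ (direction s w))⁻¹ • direction s w :=
  hφ.dualVector_smul_gradient (direction_ne_zero s w) ht

lemma dualNorm_polarMap (s : ℤˣ) {x : Model d} (hx : 0 < x 0) :
    dualNorm φ (polarMap φ s x) = x 0 := by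
  rw [polarMap, hφ.dualNorm_smul _ hx, momentum, hφ.dualNorm_gradient (direction_ne_zero _ _),
    mul_one]

lemma eq_of_polarMap_eq {s s' : ℤˣ} {x y : Model d} (hx : 0 < x 0) (hy : 0 < y 0)
    (h : polarMap φ s x = polarMap φ s' y) : s = s' ∧ x = y := by
  have h_zero : x 0 = y 0 := by rw [← hφ.dualNorm_polarMap s hx, h, hφ.dualNorm_polarMap s' hy]
  have h_pos := hφ.pos _ (direction_ne_zero s (tail x))
  have h_pos' := hφ.pos _ (direction_ne_zero s' (tail y))
  have h_dual := congrArg (dualVector φ) h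
  rw [polarMap, polarMap, hφ.dualVector_momentum s _ hx, hφ.dualVector_momentum s' _ hy,
    inv_smul_eq_iff₀ h_pos.ne', smul_smul] at h_dual
  obtain ⟨hs, h_tail⟩ := direction_eq_of_eq_smul (by positivity) h_dual
  refine ⟨hs, ?_⟩
  ext i
  cases i using Fin.cases with
  | zero => exact h_zero
  | succ k => exact congrArg (fun w : EuclideanSpace ℝ (Fin d) => w k) h_tail

lemma hasFDerivAt_polarMap (s : ℤˣ) (x : Model d) :
    HasFDerivAt (polarMap φ s)
      ((polarFrame (momentum φ s) (tail x)).comp (tailScaling (x 0))) x := by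
  have h_radius : HasFDerivAt (fun x : Model d => x 0) (EuclideanSpace.proj (𝕜 := ℝ) 0) x :=
    (EuclideanSpace.proj (𝕜 := ℝ) (0 : Fin (d + 1))).hasFDerivAt
  have h_momentum : HasFDerivAt (fun x => momentum φ s (tail x))
      ((fderiv ℝ (momentum φ s) (tail x)).comp tail) x :=
    (((hφ.contDiff_momentum s).differentiable (by simp)) (tail x)).hasFDerivAt.comp x
      tail.hasFDerivAt
  exact (h_radius.smul h_momentum).congr_fderiv
    (ContinuousLinearMap.ext fun u => (polarFrame_tailScaling (momentum φ s) (tail x) (x 0) u).symm)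

lemma polarMap_mem_dualBall (s : ℤˣ) {x : Model d} (hx : x ∈ slab d) :
    polarMap φ s x ∈ dualBall φ :=
  hφ.mem_dualBall_iff.2 ((hφ.dualNorm_polarMap s hx.1).trans_le hx.2)

lemma volume_legendre_equator :
    volume ((fun v => φ v • ∇ φ v) '' {v : Model d | v ≠ 0 ∧ v 0 = 0}) = 0 := by
  refine addHaar_image_eq_zero_of_differentiableOn_of_addHaar_eq_zero volume (fun v hv => ?_)
    (measure_mono_null (fun v hv => hv.2) volume_equator)
  exact ((hφ.differentiableAt hv.1).smul
    ((hφ.contDiffAt_gradient hv.1).differentiableAt (by simp))).differentiableWithinAt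

lemma exists_polarMap_eq {ξ : Model d} (hξ : ξ ≠ 0) (h_mem : ξ ∈ dualBall φ)
    (h_equator : ξ ∉ (fun v => φ v • ∇ φ v) '' {v : Model d | v ≠ 0 ∧ v 0 = 0}) :
    ∃ s, ∃ x ∈ slab d, polarMap φ s x = ξ := by
  set v := dualVector φ ξ
  set r := dualNorm φ ξ
  have hv_one : φ v = 1 := (hφ.dualVector_spec ξ).1
  have hv : v ≠ 0 := hφ.ne_zero_of_eq_one hv_one
  have h_eq : r • ∇ φ v = ξ := hφ.dualNorm_smul_gradient_dualVector ξ
  have hr : 0 < r := (hφ.dualNorm_nonneg ξ).lt_of_ne' fun h => hξ <| by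
    rw [← h_eq, show r = 0 from h, zero_smul]
  have h_gradient : ∀ {u : Model d}, u ≠ 0 → ∀ {t : ℝ}, 0 < t → ∇ φ (t • u) = ∇ φ u :=
    fun hu _ ht =>
      congrArg (InnerProductSpace.toDual ℝ (Model d)).symm (hφ.fderiv_smul hu ht)
  have hv_zero : v 0 ≠ 0 := fun h => h_equator
    ⟨r • v, ⟨smul_ne_zero hr.ne' hv, by simp [h]⟩, by
      simp only [hφ.homogeneous _ _ hr, hv_one, mul_one, h_gradient hv hr, h_eq]⟩
  obtain ⟨s, t, w, ht, h_dir⟩ := exists_eq_smul_direction hv_zero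
  refine ⟨s, EuclideanSpace.single 0 r + consZero w,
    ⟨by simpa using hr, by simpa using hφ.mem_dualBall_iff.1 h_mem⟩, ?_⟩
  rw [h_dir, h_gradient (direction_ne_zero s w) ht] at h_eq
  simpa [polarMap, momentum] using h_eq

lemma dualBall_ae_eq_iUnion : dualBall φ =ᵐ[volume] ⋃ s : ℤˣ, polarMap φ s '' slab d := by
  refine ae_eq_set.2 ⟨measure_mono_null (t := {0} ∪ (fun v => φ v • ∇ φ v) ''
    {v : Model d | v ≠ 0 ∧ v 0 = 0}) ?_ (measure_union_null (measure_singleton 0)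
      hφ.volume_legendre_equator), ?_⟩
  · rintro ξ ⟨h_mem, h_notMem⟩
    by_contra! h
    simp only [mem_union, mem_singleton_iff, not_or] at h
    obtain ⟨s, hs⟩ := hφ.exists_polarMap_eq h.1 h_mem h.2
    exact h_notMem (mem_iUnion.2 ⟨s, hs⟩)
  · rw [sdiff_eq_empty.2, measure_empty]
    exact iUnion_subset fun s => image_subset_iff.2 fun x hx => hφ.polarMap_mem_dualBall s hx

lemma continuous_polarFrame_det (s : ℤˣ) :
    Continuous fun w => (polarFrame (momentum φ s) w).det := by
  have h_momentum : ContDiff ℝ 1 fun p : HCoord d => momentum φ s p.2 :=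
    ((hφ.contDiff_momentum s).comp contDiff_snd).of_le (by simp)
  have h_det := continuousOn_univ.1
    (continuousOn_polarFrame_det isOpen_univ h_momentum.contDiffOn)
  exact h_det.comp (f := fun w => ((0 : Model d), w)) (by fun_prop)

lemma continuous_inv_smul_direction (s : ℤˣ) :
    Continuous fun w => (φ (direction s w))⁻¹ • direction (d := d) s w := by
  have h_dir : Continuous (direction (d := d) s) := (contDiff_direction s (m := 0)).continuous
  have h_norm : Continuous fun w => φ (direction s w) := continuous_iff_continuousAt.2 fun w =>
    ((hφ.contDiffAt _ (direction_ne_zero s w)).continuousAt).comp h_dir.continuousAt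
  exact (h_norm.inv₀ fun w => (hφ.pos _ (direction_ne_zero s w)).ne').smul h_dir

lemma lintegral_polarMap_image (s : ℤˣ) (η : Model d) :
    ∫⁻ ξ in polarMap φ s '' slab d, ENNReal.ofReal (inner ℝ η (dualVector φ ξ) ^ 2) =
      ((d : ℝ≥0∞) + 1)⁻¹ * ∫⁻ w, ENNReal.ofReal (fibreDensity φ η s w) := by
  have h_cont : Continuous (fibreDensity φ η s) := (hφ.continuous_polarFrame_det s).abs.mul
    ((continuous_const.inner (hφ.continuous_inv_smul_direction s)).pow 2)
  have h_meas : Measurable fun w => ENNReal.ofReal (fibreDensity φ η s w) :=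
    h_cont.measurable.ennreal_ofReal
  rw [lintegral_image_eq_lintegral_abs_det_fderiv_mul volume measurableSet_slab
    (fun x _ => (hφ.hasFDerivAt_polarMap s x).hasFDerivWithinAt)
    fun x hx y hy h => (hφ.eq_of_polarMap_eq hx.1 hy.1 h).2, ← lintegral_slab h_meas]
  refine setLIntegral_congr_fun measurableSet_slab fun x hx => ?_
  have h_pow : 0 ≤ x 0 ^ d := pow_nonneg hx.1.le d
  have h_det : ((polarFrame (momentum φ s) (tail x)).comp (tailScaling (x 0))).det =
      (polarFrame (momentum φ s) (tail x)).det * x 0 ^ d := by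
    rw [← det_tailScaling]
    exact LinearMap.det_comp _ _
  simp only [polarMap, hφ.dualVector_momentum s _ hx.1, fibreDensity]
  rw [h_det, abs_mul, abs_of_nonneg h_pow, ← ENNReal.ofReal_mul (by positivity),
    ← ENNReal.ofReal_mul h_pow]
  congr 1
  ring

lemma dualEnergy_eq (η : Model d) : dualEnergy φ η = ((d : ℝ≥0∞) + 1)⁻¹ * fibreEnergy φ η := by
  have h_meas : ∀ s, MeasurableSet (polarMap φ s '' slab d) := fun s =>
    measurable_image_of_fderivWithin measurableSet_slab
      (fun x _ => (hφ.hasFDerivAt_polarMap s x).hasFDerivWithinAt)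
      fun x hx y hy h => (hφ.eq_of_polarMap_eq hx.1 hy.1 h).2
  have h_disj : Pairwise (Function.onFun Disjoint fun s => polarMap φ s '' slab d) := by
    refine fun s s' hs => Set.disjoint_left.2 ?_
    rintro _ ⟨x, hx, rfl⟩ ⟨y, hy, h⟩
    exact hs (hφ.eq_of_polarMap_eq hy.1 hx.1 h).1.symm
  rw [dualEnergy, setLIntegral_congr hφ.dualBall_ae_eq_iUnion, lintegral_iUnion h_meas h_disj,
    tsum_fintype, fibreEnergy, Finset.mul_sum]
  exact Finset.sum_congr rfl fun s _ => hφ.lintegral_polarMap_image s η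

lemma fibreEnergy_le_mul {φ₀ : Model d → ℝ} (hφ₀ : IsMinkowskiNorm φ₀) {c C : ℝ} (hC : 0 < C)
    (hc : ∀ v, φ (-v) ≤ c * φ v) (hc₀ : ∀ v, φ₀ (-v) ≤ c * φ₀ v) (h_le : ∀ v, φ v ≤ C * φ₀ v)
    (h_ge : ∀ v, φ₀ v ≤ C * φ v) (η : Model d) :
    fibreEnergy φ η ≤
      ENNReal.ofReal ((2 * c * C) ^ 2 * (8 * c * C) ^ (d + 1)) * fibreEnergy φ₀ η := by
  have h := hφ.dualEnergy_le_mul hφ₀ hC hc hc₀ h_le h_ge η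
  rw [hφ.dualEnergy_eq, hφ₀.dualEnergy_eq, mul_left_comm, finrank_euclideanSpace_fin] at h
  exact (ENNReal.mul_le_mul_iff_right (by simp) (by finiteness)).1 h

end IsMinkowskiNorm

end PolarCoordinates

section Charts

lemma fderiv_fderiv_comp_equiv {E E' G : Type*} [NormedAddCommGroup E] [NormedSpace ℝ E]
    [NormedAddCommGroup E'] [NormedSpace ℝ E'] [NormedAddCommGroup G] [NormedSpace ℝ G]
    (T : E ≃L[ℝ] E') (g : E' → G) (v u u' : E) :
    fderiv ℝ (fderiv ℝ (g ∘ T)) v u u' = fderiv ℝ (fderiv ℝ g) (T v) (T u) (T u') := by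
  simpa [iteratedFDerivWithin_univ, iteratedFDeriv_two_apply] using
    congrArg (fun L => L ![u, u'])
      (T.iteratedFDerivWithin_comp_right g uniqueDiffOn_univ (mem_univ (T v)) 2)

variable {d : ℕ} {M : Type*} [TopologicalSpace M] [ChartedSpace (Model d) M]
  [IsManifold 𝓘(ℝ, Model d) ∞ M] {e : OpenPartialHomeomorph M (Model d)}

/-- The differential of the inverse of a chart, as an identification of the model space with a
tangent space. -/
def chartFrame (he : e ∈ atlas (Model d) M) {y : Model d} (hy : y ∈ e.target) :
    Model d ≃L[ℝ] TangentSpace 𝓘(ℝ, Model d) (e.symm y) :=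
  haveI : IsManifold 𝓘(ℝ, Model d) 1 M := IsManifold.of_le (n := ∞) (by simp)
  (mdifferentiable_of_mem_atlas (I := 𝓘(ℝ, Model d)) he).symm.mfderiv hy

namespace FinslerMetric

variable (F : FinslerMetric d M)

lemma inChart_eq (he : e ∈ atlas (Model d) M) {y : Model d} (hy : y ∈ e.target) (v : Model d) :
    F.inChart e y v = F.toFun ⟨e.symm y, chartFrame he hy v⟩ :=
  rfl

lemma contDiffOn_inChart (he : e ∈ atlas (Model d) M) :
    ContDiffOn ℝ ∞ (fun q : Model d × Model d => F.inChart e q.1 q.2)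
      (e.target ×ˢ {v | v ≠ 0}) := by
  have : IsManifold 𝓘(ℝ, Model d) 1 M := IsManifold.of_le (n := ∞) (by simp)
  have h_symm : ContMDiffOn 𝓘(ℝ, Model d) 𝓘(ℝ, Model d) ∞ e.symm e.target :=
    contMDiffOn_symm_of_mem_maximalAtlas (IsManifold.subset_maximalAtlas he)
  have h_tangentMap : ContMDiffOn 𝓘(ℝ, Model d).tangent 𝓘(ℝ, Model d).tangent ∞
      (tangentMap 𝓘(ℝ, Model d) 𝓘(ℝ, Model d) e.symm)
      (Bundle.TotalSpace.proj ⁻¹' e.target) := by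
    refine (h_symm.contMDiffOn_tangentMapWithin (m := ∞) (by simp)
      e.open_target.uniqueMDiffOn).congr fun p hp => ?_
    rw [tangentMapWithin_eq_tangentMap (e.open_target.uniqueMDiffWithinAt hp)]
    exact (h_symm.mdifferentiableOn (by simp)).mdifferentiableAt (e.open_target.mem_nhds hp)
  have h_coord : ContMDiffOn 𝓘(ℝ, Model d).tangent 𝓘(ℝ, Model d).tangent ∞
      (fun q : ModelProd (Model d) (Model d) => tangentMap 𝓘(ℝ, Model d) 𝓘(ℝ, Model d) e.symm
        ((tangentBundleModelSpaceHomeomorph 𝓘(ℝ, Model d)).symm q)) (e.target ×ˢ {v | v ≠ 0}) :=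
    h_tangentMap.comp contMDiff_tangentBundleModelSpaceHomeomorph_symm.contMDiffOn fun q hq => hq.1
  have h_comp := F.smooth.comp h_coord fun q hq =>
    (chartFrame he hq.1).map_ne_zero_iff.2 hq.2
  rw [← contMDiffOn_iff_contDiffOn, modelWithCornersSelf_prod]
  exact h_comp

lemma contDiffAt_inChart (he : e ∈ atlas (Model d) M) {y v : Model d} (hy : y ∈ e.target)
    (hv : v ≠ 0) : ContDiffAt ℝ ∞ (fun q : Model d × Model d => F.inChart e q.1 q.2) (y, v) :=
  (F.contDiffOn_inChart he).contDiffAt ((e.open_target.prod isOpen_ne).mem_nhds ⟨hy, hv⟩)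

lemma isMinkowskiNorm_inChart (he : e ∈ atlas (Model d) M) {y : Model d} (hy : y ∈ e.target) :
    IsMinkowskiNorm (F.inChart e y) where
  contDiffAt v hv := (F.contDiffAt_inChart he hy hv).comp v (contDiffAt_const.prodMk contDiffAt_id)
  map_zero := by rw [F.inChart_eq he hy, _root_.map_zero, F.eq_zero_iff]
  pos v hv := (F.nonneg _).lt_of_ne' fun h =>
    hv ((chartFrame he hy).map_eq_zero_iff.1 ((F.eq_zero_iff _ _).1 h))
  homogeneous v t ht := by
    simp only [F.inChart_eq he hy, map_smul, F.homogeneous _ _ t ht]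
  hessian_pos v u hv hu := by
    have h_hessian := fderiv_fderiv_comp_equiv (chartFrame he hy)
      (fun w : Model d => F.toFun ⟨e.symm y, w⟩ ^ 2) v u u
    exact (F.strongly_convex _ _ _ ((chartFrame he hy).map_ne_zero_iff.2 hv)
      ((chartFrame he hy).map_ne_zero_iff.2 hu)).trans_eq h_hessian.symm

/-- The quasireversibility constant of `F` is at most `c`; the bound on unit vectors is stated in
its homogeneous form. -/
def QuasireversibleWith (c : ℝ) : Prop :=
  ∀ (x : M) (v : TangentSpace 𝓘(ℝ, Model d) x), F.toFun ⟨x, -v⟩ ≤ c * F.toFun ⟨x, v⟩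

variable {F} {F₀ : FinslerMetric d M}

lemma QuasireversibleWith.mono {c c' : ℝ} (h : F.QuasireversibleWith c) (hc : c ≤ c') :
    F.QuasireversibleWith c' := fun x v =>
  (h x v).trans (mul_le_mul_of_nonneg_right hc (F.nonneg _))

lemma IsQuasireversibilityConstant.quasireversibleWith {c : ℝ}
    (h : F.IsQuasireversibilityConstant c) : F.QuasireversibleWith c := fun x v => by
  rcases eq_or_ne v 0 with rfl | hv
  · simp [(F.eq_zero_iff x 0).2 rfl]
  have h_pos : 0 < F.toFun ⟨x, v⟩ := (F.nonneg _).lt_of_ne' fun h => hv ((F.eq_zero_iff x v).1 h)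
  have h_unit : F.toFun ⟨x, (F.toFun ⟨x, v⟩)⁻¹ • v⟩ = 1 := by
    rw [F.homogeneous x v _ (inv_pos.2 h_pos), inv_mul_cancel₀ h_pos.ne']
  have h_le := h.1 ⟨x, _, h_unit, rfl⟩
  rw [← smul_neg, F.homogeneous x _ _ (inv_pos.2 h_pos), inv_mul_le_iff₀ h_pos] at h_le
  rwa [mul_comm]

lemma QuasireversibleWith.inChart_neg_le {c : ℝ} (h : F.QuasireversibleWith c)
    (he : e ∈ atlas (Model d) M) {y : Model d} (hy : y ∈ e.target) (v : Model d) :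
    F.inChart e y (-v) ≤ c * F.inChart e y v := by
  simpa only [F.inChart_eq he hy, map_neg] using h _ (chartFrame he hy v)

lemma BiLipschitz.symm {C : ℝ} (h : F.BiLipschitz F₀ C) (hC : 0 < C) : F₀.BiLipschitz F C :=
  fun x v hv => by
    obtain ⟨h_ge, h_le⟩ := h x v hv
    have h_pos : 0 < F.toFun ⟨x, v⟩ / F₀.toFun ⟨x, v⟩ := (inv_pos.2 hC).trans_le h_ge
    rw [← inv_div]
    exact ⟨inv_anti₀ h_pos h_le, inv_le_of_inv_le₀ hC h_ge⟩

lemma BiLipschitz.inChart_le {C : ℝ} (h : F.BiLipschitz F₀ C) (he : e ∈ atlas (Model d) M)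
    {y : Model d} (hy : y ∈ e.target) (v : Model d) :
    F.inChart e y v ≤ C * F₀.inChart e y v := by
  rcases eq_or_ne v 0 with rfl | hv
  · simp [(F.isMinkowskiNorm_inChart he hy).map_zero, (F₀.isMinkowskiNorm_inChart he hy).map_zero]
  · exact (div_le_iff₀ ((F₀.isMinkowskiNorm_inChart he hy).pos v hv)).1
      (h _ (chartFrame he hy v) ((chartFrame he hy).map_ne_zero_iff.2 hv)).2

end FinslerMetric

end Charts

section ReebField

variable {d : ℕ} {N : HCoord d → Model d} {p : HCoord d}

lemma wedgePow_covectorForm (hN : DifferentiableAt ℝ N p) :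
    wedgePow (covectorForm N p) (dOneForm (covectorForm N) p) (coordFrame d) =
      (polarFrame (fun w => N (p.1, w)) p.2).det * wedgeConst d := by
  refine wedgePow_coordFrame (fun u => ?_) fun w u => ?_
  · simp [polarFrame_fibre hN, Prod.mk_zero_zero, covectorForm, innerSL_apply_apply ℝ]
  · simp [polarFrame_fibre hN, dOneForm_covectorForm hN]

lemma IsReebAt.inner_polarFrame (hN : DifferentiableAt ℝ N p) {X : HCoord d}
    (hX : IsReebAt (covectorForm N) p X) (x : Model d) :
    inner ℝ (polarFrame (fun w => N (p.1, w)) p.2 x) X.1 = x 0 := by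
  have h_one : inner ℝ (N p) X.1 = 1 := hX.1
  have h_fibre : inner ℝ (fderiv ℝ N p (0, tail x)) X.1 = 0 := by
    simpa [dOneForm_covectorForm hN] using hX.2 (0, tail x)
  rw [polarFrame_fibre hN, inner_add_left, real_inner_smul_left, h_one, h_fibre]
  ring

lemma exists_isReebAt (hN : DifferentiableAt ℝ N p)
    (h_surj : Function.Surjective (polarFrame (fun w => N (p.1, w)) p.2)) {v : Model d}
    (hv : ∀ x, inner ℝ (polarFrame (fun w => N (p.1, w)) p.2 x) v = x 0) :
    ∃ X, IsReebAt (covectorForm N) p X := by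
  have h_one : inner ℝ (N p) v = 1 := by
    simpa [polarFrame_fibre hN, Prod.mk_zero_zero] using hv (EuclideanSpace.single 0 1)
  have h_fibre : ∀ z, inner ℝ (fderiv ℝ N p (0, z)) v = 0 := fun z => by
    simpa [polarFrame_fibre hN] using hv (consZero z)
  have h_split : ∀ Z : HCoord d, fderiv ℝ N p Z = fderiv ℝ N p (Z.1, 0) + fderiv ℝ N p (0, Z.2) :=
    fun Z => by simp [← map_add]
  let ℓ : Model d →L[ℝ] ℝ :=
    (innerSL ℝ v).comp ((fderiv ℝ N p).comp (ContinuousLinearMap.inl ℝ _ _)) -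
      innerSL ℝ (fderiv ℝ N p (v, 0))
  obtain ⟨x, hx⟩ := h_surj ((InnerProductSpace.toDual ℝ (Model d)).symm ℓ)
  have hℓ : ∀ a, inner ℝ (polarFrame (fun w => N (p.1, w)) p.2 x) a =
      inner ℝ (fderiv ℝ N p (a, 0)) v - inner ℝ (fderiv ℝ N p (v, 0)) a := fun a => by
    rw [hx, InnerProductSpace.toDual_symm_apply, real_inner_comm]
    rfl
  have hx_zero : x 0 = 0 := by rw [← hv x, hℓ, sub_self]
  refine ⟨(v, tail x), h_one, fun Z => ?_⟩
  have h_base := hℓ Z.1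
  rw [polarFrame_fibre hN, hx_zero, zero_smul, zero_add] at h_base
  rw [dOneForm_covectorForm hN, h_split (v, tail x), h_split Z, inner_add_left, inner_add_left,
    h_fibre, h_base]
  ring

lemma reeb_fst (hN : DifferentiableAt ℝ N p)
    (h_det : (polarFrame (fun w => N (p.1, w)) p.2).det ≠ 0) {v : Model d}
    (hv : ∀ x, inner ℝ (polarFrame (fun w => N (p.1, w)) p.2 x) v = x 0) :
    (reeb (covectorForm N) p).1 = v := by
  have h_surj : Function.Surjective (polarFrame (fun w => N (p.1, w)) p.2) :=
    (ContinuousLinearMap.toContinuousLinearEquivOfDetNeZero _ h_det).surjective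
  have h_reeb : IsReebAt (covectorForm N) p (reeb (covectorForm N) p) :=
    Classical.epsilon_spec (exists_isReebAt hN h_surj hv)
  refine ext_inner_left ℝ fun ζ => ?_
  obtain ⟨x, rfl⟩ := h_surj ζ
  rw [h_reeb.inner_polarFrame hN, hv]

end ReebField

section HilbertForm

variable {d : ℕ}

lemma IsMinkowskiNorm.inner_polarFrame {φ : Model d → ℝ} (hφ : IsMinkowskiNorm φ) (s : ℤˣ)
    (w : EuclideanSpace ℝ (Fin d)) (x : Model d) :
    inner ℝ (polarFrame (momentum φ s) w x) ((φ (direction s w))⁻¹ • direction s w) = x 0 := by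
  have h_pos := hφ.pos _ (direction_ne_zero s w)
  have h_self : ∀ w, inner ℝ (momentum φ s w) (direction s w) = φ (direction s w) := fun w => by
    rw [momentum, inner_gradient_left, hφ.fderiv_self (direction_ne_zero s w)]
  have h_momentum := ((hφ.contDiff_momentum s).differentiable (by simp) w).hasFDerivAt
  have h_norm := (hφ.differentiableAt (direction_ne_zero s w)).hasFDerivAt.comp w
    (hasFDerivAt_direction s w)
  have h_tangent : inner ℝ (fderiv ℝ (momentum φ s) w (tail x)) (direction s w) = 0 := by
    have h_inner := h_momentum.inner ℝ (hasFDerivAt_direction s w)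
    rw [funext h_self] at h_inner
    have h_eq := congrArg (fun L => L (tail x)) (h_inner.unique h_norm)
    simpa [momentum, inner_gradient_left] using h_eq
  rw [polarFrame_apply, real_inner_smul_right, inner_add_left, real_inner_smul_left, h_self,
    h_tangent, add_zero]
  field_simp

variable {M : Type*} [TopologicalSpace M] [ChartedSpace (Model d) M]
  [IsManifold 𝓘(ℝ, Model d) ∞ M] {e : OpenPartialHomeomorph M (Model d)}

namespace FinslerMetric

variable (F : FinslerMetric d M)

/-- The vector of the model space that represents the Hilbert form in the coordinates `(y, w)`. -/
def hilbertMomentum (e : OpenPartialHomeomorph M (Model d)) (s : ℤˣ) (p : HCoord d) : Model d :=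
  momentum (F.inChart e p.1) s p.2

lemma hilbertForm_eq (s : ℤˣ) : F.hilbertForm e s = covectorForm (F.hilbertMomentum e s) := by
  ext p X <;> simp [hilbertForm, covectorForm, hilbertMomentum, momentum, inner_gradient_left,
    innerSL_apply_apply ℝ]

lemma contDiffOn_hilbertMomentum (he : e ∈ atlas (Model d) M) (s : ℤˣ) :
    ContDiffOn ℝ ∞ (F.hilbertMomentum e s) (e.target ×ˢ univ) := fun p hp => by
  have h_metric : ContDiffAt ℝ ∞ (Function.uncurry fun q : HCoord d => F.inChart e q.1)
      (p, direction s p.2) :=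
    (F.contDiffAt_inChart he hp.1 (direction_ne_zero s p.2)).comp
      (f := fun q : HCoord d × Model d => (q.1.1, q.2)) (p, direction s p.2)
      (contDiffAt_fst.fst.prodMk contDiffAt_snd)
  have h_fderiv := h_metric.fderiv (m := ∞)
    ((contDiff_direction s).contDiffAt.comp p contDiffAt_snd) (by simp)
  exact ((InnerProductSpace.toDual ℝ (Model d)).symm.contDiff.contDiffAt.comp p
    h_fderiv).contDiffWithinAt

lemma differentiableAt_hilbertMomentum (he : e ∈ atlas (Model d) M) (s : ℤˣ) {p : HCoord d}
    (hp : p.1 ∈ e.target) : DifferentiableAt ℝ (F.hilbertMomentum e s) p :=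
  ((F.contDiffOn_hilbertMomentum he s).contDiffAt
    ((e.open_target.prod isOpen_univ).mem_nhds ⟨hp, mem_univ _⟩)).differentiableAt (by simp)

lemma contactDensity_eq (he : e ∈ atlas (Model d) M) (s : ℤˣ) {p : HCoord d}
    (hp : p.1 ∈ e.target) : F.contactDensity e s p =
      |(polarFrame (momentum (F.inChart e p.1) s) p.2).det| * |wedgeConst d| := by
  rw [contactDensity, hilbertForm_eq,
    wedgePow_covectorForm (F.differentiableAt_hilbertMomentum he s hp), abs_mul]
  rfl

lemma reeb_hilbertForm_fst (he : e ∈ atlas (Model d) M) (s : ℤˣ) {p : HCoord d}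
    (hp : p.1 ∈ e.target) (h_det : (polarFrame (momentum (F.inChart e p.1) s) p.2).det ≠ 0) :
    (reeb (F.hilbertForm e s) p).1 =
      (F.inChart e p.1 (direction s p.2))⁻¹ • direction s p.2 := by
  rw [hilbertForm_eq]
  exact reeb_fst (F.differentiableAt_hilbertMomentum he s hp) h_det
    ((F.isMinkowskiNorm_inChart he hp).inner_polarFrame s p.2)

lemma lieReeb_sq_mul_contactDensity (f : M → ℝ) (he : e ∈ atlas (Model d) M) (s : ℤˣ)
    {p : HCoord d} (hp : p.1 ∈ e.target) :
    F.lieReeb f e s p ^ 2 * F.contactDensity e s p =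
      |wedgeConst d| * fibreDensity (F.inChart e p.1) ((InnerProductSpace.toDual ℝ (Model d)).symm
        (covectorInChart (weakDifferential d f) e p.1)) s p.2 := by
  rw [F.contactDensity_eq he s hp, fibreDensity]
  by_cases h_det : (polarFrame (momentum (F.inChart e p.1) s) p.2).det = 0
  · simp [h_det]
  · rw [lieReeb, F.reeb_hilbertForm_fst he s hp h_det, InnerProductSpace.toDual_symm_apply]
    ring

end FinslerMetric

end HilbertForm

section Measurability

variable {d : ℕ}

lemma MemL2Loc.aestronglyMeasurable {G : Type*} [NormedAddCommGroup G] {U : Set (Model d)}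
    {u : Model d → G} (hu : MemL2Loc U u) (hU : IsOpen U) :
    AEStronglyMeasurable u (volume.restrict U) := by
  refine ((locallyIntegrableOn_iff hU.isLocallyClosed).2 fun S hSU hS => ?_).aestronglyMeasurable
  have : IsFiniteMeasure (volume.restrict S) := isFiniteMeasure_restrict.2 hS.measure_ne_top
  exact (hu S hSU hS).integrable one_le_two

variable {M : Type*} [TopologicalSpace M] [ChartedSpace (Model d) M]

namespace ChartPiece

variable (P : ChartPiece d M)

lemma image_subset_target : P.chart '' P.carrier ⊆ P.chart.target :=
  (P.chart.mapsTo.mono_left P.subset_source).image_subset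

lemma measurableSet_image : MeasurableSet (P.chart '' P.carrier) := by
  borelize M
  have h_symm : Measurable fun y : P.chart.target => P.chart.symm y :=
    (continuousOn_iff_continuous_domRestrict.1 P.chart.continuousOn_symm).measurable
  have h_image := MeasurableSet.subtype_image P.chart.open_target.measurableSet
    (h_symm P.measurable)
  rwa [P.chart.image_eq_target_inter_inv_preimage P.subset_source, ← Subtype.image_preimage_coe]

end ChartPiece

lemma isWeakDifferential_weakDifferential {f : M → ℝ} (hf : MemH1Loc d f) :
    IsWeakDifferential f (weakDifferential d f) := by
  have h_eq : weakDifferential d f = hf.choose := funext fun x => by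
    rw [weakDifferential, dif_pos hf]
  exact h_eq ▸ hf.choose_spec

variable [IsManifold 𝓘(ℝ, Model d) ∞ M] {e : OpenPartialHomeomorph M (Model d)}

namespace FinslerMetric

variable (F : FinslerMetric d M)

lemma continuousOn_unitDirection (he : e ∈ atlas (Model d) M) (s : ℤˣ) :
    ContinuousOn (fun p : HCoord d => (F.inChart e p.1 (direction s p.2))⁻¹ • direction s p.2)
      (e.target ×ˢ univ) := by
  have h_dir : Continuous (direction (d := d) s) := (contDiff_direction s (m := 0)).continuous
  have h_norm : ContinuousOn (fun p : HCoord d => F.inChart e p.1 (direction s p.2))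
      (e.target ×ˢ univ) :=
    (F.contDiffOn_inChart he).continuousOn.comp
      (f := fun p : HCoord d => (p.1, direction s p.2)) (by fun_prop)
      fun p hp => ⟨hp.1, direction_ne_zero s p.2⟩
  exact (h_norm.inv₀ fun p hp => ((F.isMinkowskiNorm_inChart he hp.1).pos _
    (direction_ne_zero s p.2)).ne').smul (by fun_prop)

lemma aemeasurable_fibreDensity {f : M → ℝ} (hf : MemH1Loc d f) (he : e ∈ atlas (Model d) M)
    (s : ℤˣ) : AEMeasurable (fun p : HCoord d => fibreDensity (F.inChart e p.1)
      ((InnerProductSpace.toDual ℝ (Model d)).symm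
        (covectorInChart (weakDifferential d f) e p.1)) s p.2)
      ((volume.restrict e.target).prod volume) := by
  have h_open : IsOpen (e.target ×ˢ (univ : Set (EuclideanSpace ℝ (Fin d)))) :=
    e.open_target.prod isOpen_univ
  have h_covector : AEStronglyMeasurable (fun p : HCoord d =>
      (InnerProductSpace.toDual ℝ (Model d)).symm
        (covectorInChart (weakDifferential d f) e p.1))
      ((volume.restrict e.target).prod volume) :=
    ((InnerProductSpace.toDual ℝ (Model d)).symm.continuous.comp_aestronglyMeasurable
      ((isWeakDifferential_weakDifferential hf e he).2.1.aestronglyMeasurable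
        e.open_target)).comp_fst
  have h_det := (continuousOn_polarFrame_det h_open
    ((F.contDiffOn_hilbertMomentum he s).of_le (by simp))).aemeasurable h_open.measurableSet
      (μ := volume)
  have h_unit := (F.continuousOn_unitDirection he s).aestronglyMeasurable h_open.measurableSet
    (μ := volume)
  rw [Measure.volume_eq_prod, ← Measure.restrict_prod_eq_prod_univ] at h_det h_unit
  exact h_det.abs.mul ((h_covector.inner h_unit).aemeasurable.pow_const 2)

lemma energyOn_eq {f : M → ℝ} (hf : MemH1Loc d f) (P : ChartPiece d M) :
    F.energyOn f P = ENNReal.ofReal |wedgeConst d| * ∫⁻ y in P.chart '' P.carrier,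
      fibreEnergy (F.inChart P.chart y) ((InnerProductSpace.toDual ℝ (Model d)).symm
        (covectorInChart (weakDifferential d f) P.chart y)) := by
  have h_meas := fun s => ((F.aemeasurable_fibreDensity hf P.chart_mem s).mono_measure
    (Measure.prod_mono (Measure.restrict_mono P.image_subset_target le_rfl)
      le_rfl)).ennreal_ofReal
  unfold fibreEnergy
  rw [lintegral_finsetSum' _ fun s _ => (h_meas s).lintegral_prod_right', Finset.mul_sum, energyOn]
  refine Finset.sum_congr rfl fun s _ => ?_
  rw [← lintegral_prod _ (h_meas s), ← lintegral_const_mul' _ _ ENNReal.ofReal_ne_top,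
    Measure.restrict_prod_eq_prod_univ, ← Measure.volume_eq_prod]
  refine setLIntegral_congr_fun (P.measurableSet_image.prod MeasurableSet.univ) fun p hp => ?_
  simp only [F.lieReeb_sq_mul_contactDensity f P.chart_mem s (P.image_subset_target hp.1),
    ENNReal.ofReal_mul (abs_nonneg _)]

end FinslerMetric

end Measurability

section Comparison

variable {d : ℕ} {M : Type*} [TopologicalSpace M] [ChartedSpace (Model d) M]
  [IsManifold 𝓘(ℝ, Model d) ∞ M] {F F₀ : FinslerMetric d M} {f : M → ℝ}

namespace FinslerMetric

lemma energy_le_of_energyOn_le {κ : ℝ≥0∞}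
    (h : ∀ P : ChartPiece d M, F.energyOn f P ≤ κ * F₀.energyOn f P) :
    F.energy f ≤ κ * F₀.energy f := by
  rw [energy, energy, mul_left_comm]
  refine mul_le_mul_right (iSup₂_le fun S hS => ?_) _
  calc ∑ P ∈ S, F.energyOn f P ≤ κ * ∑ P ∈ S, F₀.energyOn f P := by
        rw [Finset.mul_sum]
        exact Finset.sum_le_sum fun P _ => h P
    _ ≤ _ := by
        gcongr
        exact le_iSup₂ (f := fun (S : Finset (ChartPiece d M))
          (_ : (S : Set (ChartPiece d M)).PairwiseDisjoint ChartPiece.carrier) =>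
            ∑ P ∈ S, F₀.energyOn f P) S hS

lemma energy_le {c C : ℝ} (hC : 0 < C) (h : F.BiLipschitz F₀ C)
    (hc : F.QuasireversibleWith c) (hc₀ : F₀.QuasireversibleWith c) (hf : MemH1Loc d f) :
    F.energy f ≤ ENNReal.ofReal ((2 * c * C) ^ 2 * (8 * c * C) ^ (d + 1)) * F₀.energy f := by
  refine energy_le_of_energyOn_le fun P => ?_
  rw [F.energyOn_eq hf, F₀.energyOn_eq hf, mul_left_comm]
  refine mul_le_mul_right ?_ _
  rw [← lintegral_const_mul' _ _ ENNReal.ofReal_ne_top]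
  refine setLIntegral_mono' P.measurableSet_image fun y hy => ?_
  have hy' := P.image_subset_target hy
  exact (F.isMinkowskiNorm_inChart P.chart_mem hy').fibreEnergy_le_mul
    (F₀.isMinkowskiNorm_inChart P.chart_mem hy') hC (hc.inChart_neg_le P.chart_mem hy')
    (hc₀.inChart_neg_le P.chart_mem hy') (h.inChart_le P.chart_mem hy')
    ((h.symm hC).inChart_le P.chart_mem hy') _

end FinslerMetric

end Comparison

end Finsler

end

theorem theorem3p1_general (d : ℕ) (C C₁ C₂ : ℝ) (hC : 1 < C) :
    ∃ K : ℝ, 1 ≤ K ∧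
      ∀ (M : Type*) [TopologicalSpace M] [ChartedSpace (Finsler.Model d) M]
        [IsManifold 𝓘(ℝ, Finsler.Model d) ∞ M] (F F₀ : Finsler.FinslerMetric d M),
        F.BiLipschitz F₀ C → F.QuasireversibleWith C₁ → F₀.QuasireversibleWith C₂ →
        ∀ f : M → ℝ, Finsler.MemH1Loc d f →
          ENNReal.ofReal (C ^ (-K)) * F₀.energy f ≤ F.energy f ∧
            F.energy f ≤ ENNReal.ofReal (C ^ K) * F₀.energy f := by
  have hC₀ : 0 < C := one_pos.trans hC
  set c := max 1 (max C₁ C₂)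
  set κ := (2 * c * C) ^ 2 * (8 * c * C) ^ (d + 1)
  set K := max 1 (Real.logb C κ)
  have hκ : 0 < κ := by
    have : 0 < c := one_pos.trans_le (le_max_left _ _)
    positivity
  have hκK : κ ≤ C ^ K :=
    (Real.logb_le_iff_le_rpow hC hκ).1 (le_max_right _ _)
  refine ⟨K, le_max_left _ _, fun M _ _ _ F F₀ h h₁ h₂ f hf => ?_⟩
  have hc₁ : F.QuasireversibleWith c := h₁.mono ((le_max_left _ _).trans (le_max_right _ _))
  have hc₂ : F₀.QuasireversibleWith c := h₂.mono ((le_max_right _ _).trans (le_max_right _ _))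
  have h_le : F.energy f ≤ ENNReal.ofReal (C ^ K) * F₀.energy f :=
    (Finsler.FinslerMetric.energy_le hC₀ h hc₁ hc₂ hf).trans (by gcongr)
  have h_ge : F₀.energy f ≤ ENNReal.ofReal (C ^ K) * F.energy f :=
    (Finsler.FinslerMetric.energy_le hC₀ (h.symm hC₀) hc₂ hc₁ hf).trans (by gcongr)
  refine ⟨?_, h_le⟩
  rw [Real.rpow_neg hC₀.le, ENNReal.ofReal_inv_of_pos (by positivity)]
  rw [mul_comm, ← div_eq_mul_inv]
  exact ENNReal.div_le_of_le_mul' h_ge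

theorem theorem3p1 (d : ℕ) (C C₁ C₂ : ℝ) (hC : 1 < C) :
    ∃ K : ℝ, 1 ≤ K ∧
      ∀ (M : Type*) [TopologicalSpace M] [T2Space M] [SecondCountableTopology M]
        [ChartedSpace (Finsler.Model d) M] [IsManifold 𝓘(ℝ, Finsler.Model d) ∞ M]
        (F F₀ : Finsler.FinslerMetric d M),
        F.BiLipschitz F₀ C →
        F.IsQuasireversibilityConstant C₁ →
        F₀.IsQuasireversibilityConstant C₂ →
        ∀ f : M → ℝ, Finsler.MemH1Loc d f →
          ENNReal.ofReal (C ^ (-K)) * F₀.energy f ≤ F.energy f ∧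
            F.energy f ≤ ENNReal.ofReal (C ^ K) * F₀.energy f := by
  obtain ⟨K, hK, h⟩ := theorem3p1_general d C C₁ C₂ hC
  exact ⟨K, hK, fun M _ _ _ _ _ F F₀ hF h₁ h₂ =>
    h M F F₀ hF h₁.quasireversibleWith h₂.quasireversibleWith⟩
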